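/- Let $p>2$ be a prime number, $k=\mathbb F_p$, $G=SL_2$ over $k$ with Lie algebra $\mathcal G$, and $X=\mathbb P^1_k$ with its relative Frobenius morphism $F:X\to X'$; since $k=\mathbb F_p$ one has $X'=X$, and $F$ is the identity on the space and $f\mapsto f^p$ on functions. Let $m\ge 0$ be an integer. *Definitions.* For an associative $k$-algebra $A$ with an increasing filtration $(A_n)_{n\ge 0}$ by subspaces such that $k1_A\subset A_0$, $A_aA_b\subset A_{a+b}$ and $[A_a,A_b]\subset A_{a+b-1}$ for $a+b\ge 1$, let $$A^{(m)}:=\mathbb T_k(A_{2p^m-1})\big/\big(\lambda-\lambda 1_A,\ (D\otimes D'-D'\otimes D)-[D,D'],\ D\otimes D''-DD''\ :\ \lambda\in k,\ D,D'\in A_{p^m},\ D''\in A_{p^m-1}\big),$$ where $\mathbb T_k$ is the tensor algebra over $k$. (a) $\mathcal D_X^{(m)}$ is the sheaf of rings on $X$ whose sections over an affine open subset $\operatorname{Spec}R$ of one of the two standard charts of $X$ are $A^{(m)}$, for $A=\mathcal D_R$ the algebra of $k$-linear differential operators of $R$, filtered by the order. $F^*\mathcal D^{(m)}_{X}$ is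 its inverse image by $F$ as a left $\mathcal O_X$-module, with sections $R\otimes_{F,R}\mathcal D_R^{(m)}$, where $rf^p\otimes P=r\otimes fP$. (b) $U^{(m)}(\mathcal G)$ is $A^{(m)}$ for $A=\mathrm{Dist}(G)$, the algebra of distributions of $G$ supported at the identity with the convolution product, filtered by the order: $\mathrm{Dist}(G)_n$ consists of the $k$-linear forms on $k[G]$ that vanish on $\mathfrak m^{n+1}$, with $\mathfrak m$ the ideal of the identity. (c) $Fr:U^{(m+1)}(\mathcal G)\to U^{(m)}(\mathcal G)$ is the morphism of $k$-algebras induced by the transpose of the Frobenius morphism of $G$, that is by $(Fr\,\mu)(f)=\mu(f^p)$ for $\mu\in\mathrm{Dist}(G)$ and $f\in k[G]$. (d) $\rho_m:U^{(m)}(\mathcal G)\to H^0(X,\mathcal D^{(m)}_X)$ is the morphism of $k$-algebras induced by the right action $[z_0:z_1]\mapsto[z_0:z_1]\,g$ of $G$ on $X$: a distribution $\mu$ of order $\le 2p^m-1$ acts on the functions of each standard chart by $f\mapsto(\mathrm{id}\otimes\mu)(\alpha f)$, where $\alpha$ is the coaction of the infinitesimal neighbourhoods of the identity of $G$. (e)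 $can:\mathcal D^{(m+1)}_X\to F^*\mathcal D^{(m)}_{X'}$ is Berthelot's canonical map $P\mapsto P\cdot(1\otimes 1)$ for the left action of $\mathcal D^{(m+1)}_X$ on $F^*\mathcal D^{(m)}_{X'}$. In terms of a local coordinate, it is the $\mathcal O_X$-linear map that sends the divided power $\partial^{\langle l\rangle}$ of level $m+1$ to $1\otimes\partial^{\langle l/p\rangle}$, with the divided power of level $m$, if $p\mid l$, and to $0$ otherwise. *Statement.* The following square commutes: $$\begin{array}{ccc}U^{(m)}(\mathcal G)&\xleftarrow{\ Fr\ }&U^{(m+1)}(\mathcal G)\\ {\scriptstyle 1\otimes\rho_m}\downarrow&&\downarrow{\scriptstyle\rho_{m+1}}\\ H^0(X,F^*\mathcal D^{(m)}_{X'})&\xleftarrow{\ can\ }&H^0(X,\mathcal D^{(m+1)}_X)\end{array}$$ that is, $can(\rho_{m+1}(u))=1\otimes\rho_m(Fr(u))$ in $H^0(X,F^*\mathcal D^{(m)}_{X'})$ for every $u\in U^{(m+1)}(\mathcal G)$. -/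

import Mathlib

open scoped TensorProduct Polynomial LaurentPolynomial

noncomputable section

namespace ArithD

/-! ### Algebras of level `m` attached to a filtered algebra -/

section Level

variable {k A : Type*} [CommRing k] [Ring A] [Algebra k A]

/-- The relations `λ - λ1`, `D ⊗ D' - D' ⊗ D - [D, D']`, `D ⊗ D'' - D D''` (for `λ ∈ k`,
`D, D'` of order `≤ p ^ m`, `D''` of order `≤ p ^ m - 1`) in the tensor algebra over `k` of the
part of order `≤ 2 p ^ m - 1` of a filtered algebra. -/
inductive LevelRel (p m : ℕ) (Fil : ℕ → Submodule k A) :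
    TensorAlgebra k (Fil (2 * p ^ m - 1)) → TensorAlgebra k (Fil (2 * p ^ m - 1)) → Prop
  | scalar (c : k) (e : Fil (2 * p ^ m - 1)) (he : (e : A) = algebraMap k A c) :
      LevelRel p m Fil (TensorAlgebra.ι k e) (algebraMap k _ c)
  | comm (D D' e : Fil (2 * p ^ m - 1)) (hD : (D : A) ∈ Fil (p ^ m)) (hD' : (D' : A) ∈ Fil (p ^ m))
      (he : (e : A) = D * D' - D' * D) :
      LevelRel p m Fil (TensorAlgebra.ι k D * TensorAlgebra.ι k D'
        - TensorAlgebra.ι k D' * TensorAlgebra.ι k D) (TensorAlgebra.ι k e)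
  | mul (D D'' e : Fil (2 * p ^ m - 1)) (hD : (D : A) ∈ Fil (p ^ m))
      (hD'' : (D'' : A) ∈ Fil (p ^ m - 1)) (he : (e : A) = D * D'') :
      LevelRel p m Fil (TensorAlgebra.ι k D * TensorAlgebra.ι k D'') (TensorAlgebra.ι k e)

/-- The level `m` algebra of a filtered `k`-algebra `(A, Fil)`. -/
def LevelAlg (p m : ℕ) (Fil : ℕ → Submodule k A) : Type _ :=
  RingQuot (LevelRel p m Fil)

instance (p m : ℕ) (Fil : ℕ → Submodule k A) : Ring (LevelAlg p m Fil) :=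
  inferInstanceAs (Ring (RingQuot (LevelRel p m Fil)))

instance (p m : ℕ) (Fil : ℕ → Submodule k A) : Algebra k (LevelAlg p m Fil) :=
  inferInstanceAs (Algebra k (RingQuot (LevelRel p m Fil)))

namespace LevelAlg

variable {p m : ℕ} {Fil : ℕ → Submodule k A}

/-- The class of an element of order `≤ 2 p ^ m - 1`. -/
def of : Fil (2 * p ^ m - 1) →ₗ[k] LevelAlg p m Fil :=
  (RingQuot.mkAlgHom k (LevelRel p m Fil)).toLinearMap ∘ₗ TensorAlgebra.ι k

/-- The universal property of the level `m` algebra. -/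
def lift {C : Type*} [Ring C] [Algebra k C] (f : Fil (2 * p ^ m - 1) →ₗ[k] C)
    (h1 : ∀ (c : k) (e : Fil (2 * p ^ m - 1)), (e : A) = algebraMap k A c → f e = algebraMap k C c)
    (h2 : ∀ D D' e : Fil (2 * p ^ m - 1), (D : A) ∈ Fil (p ^ m) → (D' : A) ∈ Fil (p ^ m) →
      (e : A) = D * D' - D' * D → f D * f D' - f D' * f D = f e)
    (h3 : ∀ D D'' e : Fil (2 * p ^ m - 1), (D : A) ∈ Fil (p ^ m) → (D'' : A) ∈ Fil (p ^ m - 1) →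
      (e : A) = D * D'' → f D * f D'' = f e) : LevelAlg p m Fil →ₐ[k] C :=
  RingQuot.liftAlgHom k ⟨TensorAlgebra.lift k f, by
    intro x y h
    induction h with
    | scalar c e he => simpa using h1 c e he
    | comm D D' e hD hD' he => simpa using h2 D D' e hD hD' he
    | mul D D'' e hD hD'' he => simpa using h3 D D'' e hD hD'' he⟩

theorem lift_of {C : Type*} [Ring C] [Algebra k C] (f : Fil (2 * p ^ m - 1) →ₗ[k] C) (h1 h2 h3)
    (e : Fil (2 * p ^ m - 1)) : lift f h1 h2 h3 (of e) = f e := by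
  have h := RingQuot.liftAlgHom_mkAlgHom_apply (S := k) (s := LevelRel p m Fil)
    (TensorAlgebra.lift k f) (w := by
      intro x y h
      induction h with
      | scalar c e he => simpa using h1 c e he
      | comm D D' e hD hD' he => simpa using h2 D D' e hD hD' he
      | mul D D'' e hD hD'' he => simpa using h3 D D'' e hD hD'' he) (TensorAlgebra.ι k e)
  rw [TensorAlgebra.lift_ι_apply] at h
  exact h

theorem hom_ext {C : Type*} [Ring C] [Algebra k C] {f g : LevelAlg p m Fil →ₐ[k] C}
    (h : ∀ e, f (of e) = g (of e)) : f = g := by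
  apply RingQuot.ringQuot_ext'
  apply TensorAlgebra.hom_ext
  ext e
  exact h e

theorem of_scalar (c : k) (e : Fil (2 * p ^ m - 1)) (he : (e : A) = algebraMap k A c) :
    of e = algebraMap k (LevelAlg p m Fil) c := by
  have h := RingQuot.mkAlgHom_rel k (LevelRel.scalar c e he)
  rw [AlgHom.commutes] at h
  exact h

theorem of_comm (D D' e : Fil (2 * p ^ m - 1)) (hD : (D : A) ∈ Fil (p ^ m))
    (hD' : (D' : A) ∈ Fil (p ^ m)) (he : (e : A) = D * D' - D' * D) :
    of D * of D' - of D' * of D = of e := by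
  have h := RingQuot.mkAlgHom_rel k (LevelRel.comm D D' e hD hD' he)
  simp only [map_sub, map_mul] at h
  exact h

theorem of_mul (D D' e : Fil (2 * p ^ m - 1)) (hD : (D : A) ∈ Fil (p ^ m))
    (hD' : (D' : A) ∈ Fil (p ^ m - 1)) (he : (e : A) = D * D') :
    of D * of D' = of e := by
  have h := RingQuot.mkAlgHom_rel k (LevelRel.mul D D' e hD hD' he)
  simp only [map_mul] at h
  exact h

end LevelAlg

end Level

/-! ### Differential operators -/

section DiffOp

variable (k R : Type*) [CommRing k] [CommRing R] [Algebra k R]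

/-- The commutator `P ↦ P f - f P` of `k`-linear operators with the multiplication by `f`. -/
def ad (f : R) : Module.End k R →ₗ[k] Module.End k R :=
  LinearMap.mulRight k (Algebra.lmul k R f) - LinearMap.mulLeft k (Algebra.lmul k R f)

/-- The `k`-linear differential operators of order `≤ n` of the `k`-algebra `R`. -/
def diffOp : ℕ → Submodule k (Module.End k R)
  | 0 => ⨅ f : R, LinearMap.ker (ad k R f)
  | n + 1 => ⨅ f : R, (diffOp n).comap (ad k R f)

variable {k R}

theorem ad_apply (f : R) (P : Module.End k R) :
    ad k R f P = P * Algebra.lmul k R f - Algebra.lmul k R f * P := rfl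

theorem ad_apply_apply (f : R) (P : Module.End k R) (h : R) :
    ad k R f P h = P (f * h) - f * P h := rfl

theorem mem_diffOp_zero {P : Module.End k R} : P ∈ diffOp k R 0 ↔ ∀ f, ad k R f P = 0 := by
  simp [diffOp]

theorem mem_diffOp_succ {n : ℕ} {P : Module.End k R} :
    P ∈ diffOp k R (n + 1) ↔ ∀ f, ad k R f P ∈ diffOp k R n := by
  simp [diffOp]

theorem lmul_mem (f : R) : Algebra.lmul k R f ∈ diffOp k R 0 := by
  rw [mem_diffOp_zero]
  intro g
  ext h
  simp [ad_apply_apply, mul_left_comm]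

theorem eq_lmul {P : Module.End k R} (hP : P ∈ diffOp k R 0) : P = Algebra.lmul k R (P 1) := by
  ext h
  have := congrArg (fun Q : Module.End k R => Q 1) (mem_diffOp_zero.1 hP h)
  simp only [ad_apply_apply, LinearMap.zero_apply, mul_one, sub_eq_zero] at this
  simp [this, mul_comm]

theorem diffOp_le_succ (n : ℕ) : diffOp k R n ≤ diffOp k R (n + 1) := by
  induction n with
  | zero =>
    intro P hP
    rw [mem_diffOp_succ]
    intro f
    rw [mem_diffOp_zero.1 hP f]
    exact zero_mem _
  | succ n ih =>
    intro P hP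
    rw [mem_diffOp_succ] at hP ⊢
    exact fun f => ih (hP f)

theorem diffOp_mono {a b : ℕ} (h : a ≤ b) : diffOp k R a ≤ diffOp k R b :=
  monotone_nat_of_le_succ diffOp_le_succ h

theorem ad_mul (f : R) (P Q : Module.End k R) :
    ad k R f (P * Q) = ad k R f P * Q + P * ad k R f Q := by
  simp only [ad_apply, sub_mul, mul_sub, mul_assoc]; abel

theorem mul_mem_diffOp (n : ℕ) : ∀ (a b : ℕ), a + b = n → ∀ {P Q : Module.End k R},
    P ∈ diffOp k R a → Q ∈ diffOp k R b → P * Q ∈ diffOp k R n := by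
  induction n with
  | zero =>
    intro a b hab P Q hP hQ
    obtain ⟨rfl, rfl⟩ : a = 0 ∧ b = 0 := by omega
    rw [mem_diffOp_zero] at *
    intro f
    simp [ad_mul, hP, hQ]
  | succ n ih =>
    intro a b hab P Q hP hQ
    rw [mem_diffOp_succ]
    intro f
    rw [ad_mul]
    refine add_mem ?_ ?_
    · cases a with
      | zero => rw [mem_diffOp_zero.1 hP f, zero_mul]; exact zero_mem _
      | succ a => exact ih a b (by omega) (mem_diffOp_succ.1 hP f) hQ
    · cases b with
      | zero => rw [mem_diffOp_zero.1 hQ f, mul_zero]; exact zero_mem _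
      | succ b => exact ih a b (by omega) hP (mem_diffOp_succ.1 hQ f)

theorem lmul_mul_mem {n : ℕ} (f : R) {P : Module.End k R} (hP : P ∈ diffOp k R n) :
    Algebra.lmul k R f * P ∈ diffOp k R n :=
  mul_mem_diffOp n 0 n (by omega) (lmul_mem f) hP

theorem mul_lmul_mem {n : ℕ} (f : R) {P : Module.End k R} (hP : P ∈ diffOp k R n) :
    P * Algebra.lmul k R f ∈ diffOp k R n :=
  mul_mem_diffOp n n 0 (by omega) hP (lmul_mem f)

theorem ad_comm (f g : R) (P : Module.End k R) :
    ad k R f (ad k R g P) = ad k R g (ad k R f P) := by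
  ext h
  simp only [ad_apply_apply]
  rw [mul_left_comm f g h]
  ring

theorem ad_mul_left (u v : R) (P : Module.End k R) :
    ad k R (u * v) P = ad k R u P * Algebra.lmul k R v + Algebra.lmul k R u * ad k R v P := by
  ext h
  simp [ad_apply_apply, mul_assoc, mul_sub]

theorem ad_lmul_mul (f g : R) (P : Module.End k R) :
    ad k R g (Algebra.lmul k R f * P) = Algebra.lmul k R f * ad k R g P := by
  ext h
  simp [ad_apply_apply, mul_sub, mul_left_comm]

end DiffOp

/-! ### Restriction of differential operators to a principal open subset -/

section Restrict

variable {k R B : Type*} [CommRing k] [CommRing R] [Algebra k R] [CommRing B] [Algebra k B]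

/-- `φ` is injective and identifies `B` with the localization `R[1/x]`. -/
structure IsLoc (φ : R →ₐ[k] B) (x : R) : Prop where
  inj : Function.Injective φ
  unit : IsUnit (φ x)
  surj : ∀ b : B, ∃ (n : ℕ) (r : R), φ x ^ n * b = φ r

variable {φ : R →ₐ[k] B} {x : R}

theorem IsLoc.ext_zero (hφ : IsLoc φ x) : ∀ (n : ℕ) {Q : Module.End k B}, Q ∈ diffOp k B n →
    (∀ f, Q (φ f) = 0) → Q = 0 := by
  have key : ∀ {Q : Module.End k B}, (∀ f, Q (φ f) = 0) → (∀ r, ad k B (φ r) Q = 0) → Q = 0 := by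
    intro Q h h'
    ext b
    obtain ⟨N, r, hr⟩ := hφ.surj b
    have := congrArg (fun Q : Module.End k B => Q b) (h' (x ^ N))
    simp only [ad_apply_apply, map_pow, hr, h, zero_sub, LinearMap.zero_apply, neg_eq_zero] at this
    simpa using ((hφ.unit.pow N).mul_right_eq_zero).1 this
  intro n
  induction n with
  | zero => exact fun {Q} hQ h => key h fun r => mem_diffOp_zero.1 hQ _
  | succ n ih =>
    intro Q hQ h
    refine key h fun r => ih (mem_diffOp_succ.1 hQ _) fun f => ?_
    rw [ad_apply_apply, ← map_mul, h, h, mul_zero, sub_zero]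

theorem IsLoc.ext (hφ : IsLoc φ x) {n : ℕ} {Q Q' : Module.End k B} (hQ : Q ∈ diffOp k B n)
    (hQ' : Q' ∈ diffOp k B n) (h : ∀ f, Q (φ f) = Q' (φ f)) : Q = Q' :=
  sub_eq_zero.1 (hφ.ext_zero n (sub_mem hQ hQ') fun f => by simp [h])

theorem IsLoc.exists_of_ad (hφ : IsLoc φ x) (P : Module.End k R) (Q : R → Module.End k B)
    (hQ : ∀ u f, Q u (φ f) = φ (ad k R u P f))
    (hmul : ∀ u v, Q (u * v) = Q u * Algebra.lmul k B (φ v) + Algebra.lmul k B (φ u) * Q v)  :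
    ∃ S : Module.End k B, (∀ f, S (φ f) = φ (P f)) ∧ ∀ u, ad k B (φ u) S = Q u := by
  choose N r hr using hφ.surj
  have hu : ∀ n, IsUnit (φ (x ^ n)) := fun n => by rw [map_pow]; exact hφ.unit.pow n
  -- the value at `b` computed with the denominator `x ^ n`
  have key : ∀ (b : B) (n : ℕ) (s : R), φ (x ^ n) * b = φ s → ∀ (n' : ℕ) (s' : R),
      φ (x ^ n') * b = φ s' → ∀ c, φ (x ^ n) * c = φ (P s) - Q (x ^ n) b →
      φ (x ^ n') * c = φ (P s') - Q (x ^ n') b := by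
    intro b n s hs n' s' hs' c hc
    have e1 : x ^ n' * s = x ^ n * s' := by
      apply hφ.inj
      rw [map_mul, map_mul, ← hs, ← hs']; ring
    have a1 := hQ (x ^ n') s
    have a2 := hQ (x ^ n) s'
    have m1 := congrArg (fun T : Module.End k B => T b) (hmul (x ^ n') (x ^ n))
    have m2 := congrArg (fun T : Module.End k B => T b) (hmul (x ^ n) (x ^ n'))
    simp only [LinearMap.add_apply, Module.End.mul_apply, Algebra.coe_lmul_eq_mul,
      LinearMap.mul_apply', hs, hs'] at m1 m2
    rw [mul_comm (x ^ n') (x ^ n), m2] at m1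
    rw [ad_apply_apply, map_sub, map_mul φ] at a1 a2
    rw [e1] at a1
    apply (hu n).mul_left_cancel
    linear_combination φ (x ^ n') * hc + m1 + a1 - a2
  have hex : ∀ b, ∃ c, φ (x ^ N b) * c = φ (P (r b)) - Q (x ^ N b) b := fun b =>
    ⟨↑(hu (N b)).unit⁻¹ * (φ (P (r b)) - Q (x ^ N b) b), by
      rw [← mul_assoc, IsUnit.mul_val_inv, one_mul]⟩
  choose c hc using hex
  have hc' : ∀ (b : B) (n : ℕ) (s : R), φ (x ^ n) * b = φ s →
      φ (x ^ n) * c b = φ (P s) - Q (x ^ n) b := fun b n s hs =>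
    key b (N b) (r b) (by rw [map_pow]; exact hr b) n s hs (c b) (hc b)
  have hr' : ∀ b, φ (x ^ N b) * b = φ (r b) := fun b => by rw [map_pow]; exact hr b
  have hr2 : ∀ (b : B) (n : ℕ), φ (x ^ (n + N b)) * b = φ (x ^ n * r b) := fun b n => by
    rw [pow_add, map_mul, map_mul, mul_assoc, hr']
  refine ⟨⟨⟨c, fun a b => ?_⟩, fun t b => ?_⟩, fun f => ?_, fun u => ?_⟩
  · have ha := hr2 a (N b)
    have hb := hr2 b (N a)
    rw [add_comm (N a)] at hb
    have hab : φ (x ^ (N b + N a)) * (a + b) = φ (x ^ N b * r a + x ^ N a * r b) := by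
      rw [mul_add, ha, hb, map_add]
    apply (hu (N b + N a)).mul_left_cancel
    rw [mul_add, hc' _ _ _ hab, hc' _ _ _ ha, hc' _ _ _ hb]
    simp only [map_add]; ring
  · have ht : φ (x ^ N b) * (t • b) = φ (t • r b) := by
      rw [mul_smul_comm, hr', map_smul]
    apply (hu (N b)).mul_left_cancel
    rw [hc' _ _ _ ht]
    simp only [map_smul, RingHom.id_apply, mul_smul_comm]
    rw [hc' _ _ _ (hr' b), smul_sub]
  · have h0 : φ (x ^ 0) * φ f = φ f := by simp
    have h1 := hc' _ 0 f h0
    have h2 := hQ (x ^ 0) f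
    rw [h2] at h1
    simpa [ad_apply_apply] using h1
  · ext b
    change c (φ u * b) - φ u * c b = Q u b
    have h1 : φ (x ^ N b) * (φ u * b) = φ (u * r b) := by
      rw [map_mul, ← hr', ]; ring
    apply (hu (N b)).mul_left_cancel
    rw [mul_sub, hc' _ _ _ h1, mul_left_comm, hc' _ _ _ (hr' b)]
    have a1 := hQ u (r b)
    have m1 := congrArg (fun T : Module.End k B => T b) (hmul u (x ^ N b))
    have m2 := congrArg (fun T : Module.End k B => T b) (hmul (x ^ N b) u)
    simp only [LinearMap.add_apply, Module.End.mul_apply, Algebra.coe_lmul_eq_mul,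
      LinearMap.mul_apply', hr'] at m1 m2
    rw [mul_comm u, m2] at m1
    rw [ad_apply_apply, map_sub, map_mul φ] at a1
    linear_combination -a1 - m1

theorem IsLoc.mem_succ (hφ : IsLoc φ x) {S : Module.End k B} {n : ℕ}
    (h : ∀ u, ad k B (φ u) S ∈ diffOp k B n) : S ∈ diffOp k B (n + 1) := by
  rw [mem_diffOp_succ]
  intro b
  obtain ⟨N, r, hr⟩ := hφ.surj b
  have h1 := ad_mul_left (φ (x ^ N)) b S
  rw [map_pow, hr] at h1
  obtain ⟨w, hw⟩ := hφ.unit.pow N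
  have h2 : ad k B b S = Algebra.lmul k B (↑w⁻¹ : B) * (ad k B (φ r) S
      - ad k B (φ (x ^ N)) S * Algebra.lmul k B b) := by
    rw [h1, map_pow φ, add_sub_cancel_left, ← mul_assoc, ← map_mul, ← hw, Units.inv_mul, map_one,
      one_mul]
  rw [h2]
  exact lmul_mul_mem _ (sub_mem (h r) (mul_lmul_mem _ (h _)))

theorem IsLoc.mem_zero (hφ : IsLoc φ x) {S : Module.End k B}
    (h : ∀ u, ad k B (φ u) S = 0) : S ∈ diffOp k B 0 := by
  rw [mem_diffOp_zero]
  intro b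
  obtain ⟨N, r, hr⟩ := hφ.surj b
  have h1 := ad_mul_left (φ (x ^ N)) b S
  rw [map_pow, hr, h, ← map_pow, h, zero_mul, zero_add, map_pow] at h1
  obtain ⟨w, hw⟩ := hφ.unit.pow N
  have h2 : ad k B b S = Algebra.lmul k B (↑w⁻¹ : B) * (Algebra.lmul k B (φ x ^ N) *
      ad k B b S) := by
    rw [← mul_assoc, ← map_mul, ← hw, Units.inv_mul, map_one, one_mul]
  rw [h2, ← h1, mul_zero]

theorem IsLoc.exists_ext (hφ : IsLoc φ x) : ∀ (n : ℕ) {P : Module.End k R}, P ∈ diffOp k R n →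
    ∃ S ∈ diffOp k B n, ∀ f, S (φ f) = φ (P f) := by
  intro n
  induction n with
  | zero =>
    intro P hP
    refine ⟨Algebra.lmul k B (φ (P 1)), lmul_mem _, fun f => ?_⟩
    conv_rhs => rw [eq_lmul hP]
    simp
  | succ n ih =>
    intro P hP
    choose Q hQ hQ' using fun u => ih (mem_diffOp_succ.1 hP u)
    obtain ⟨S, h1, h2⟩ := hφ.exists_of_ad P Q hQ' (fun u v => by
      refine hφ.ext (hQ _) (add_mem (mul_lmul_mem _ (hQ u)) (lmul_mul_mem _ (hQ v))) fun f => ?_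
      simp only [LinearMap.add_apply, Module.End.mul_apply, Algebra.coe_lmul_eq_mul,
        LinearMap.mul_apply', hQ', ← map_mul, ← map_add, ad_mul_left])
    exact ⟨S, hφ.mem_succ fun u => by rw [h2]; exact hQ u, h1⟩

/-- The restriction of a differential operator of order `≤ n` to a principal open subset: the
unique differential operator of order `≤ n` of the localization which extends it. -/
def resOp (hφ : IsLoc φ x) (n : ℕ) : diffOp k R n →ₗ[k] diffOp k B n :=
  have hs := fun P : diffOp k R n => (hφ.exists_ext n P.2).choose_spec
  { toFun P := ⟨(hφ.exists_ext n P.2).choose, (hs P).1⟩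
    map_add' P Q := Subtype.ext (hφ.ext (hs (P + Q)).1 (add_mem (hs P).1 (hs Q).1) fun f =>
      ((hs (P + Q)).2 f).trans (by simp [(hs P).2, (hs Q).2]))
    map_smul' c P := Subtype.ext (hφ.ext (hs (c • P)).1 (Submodule.smul_mem _ c (hs P).1) fun f =>
      ((hs (c • P)).2 f).trans (by simp [(hs P).2])) }

theorem resOp_apply (hφ : IsLoc φ x) (n : ℕ) (P : diffOp k R n) (f : R) :
    (resOp hφ n P : Module.End k B) (φ f) = φ ((P : Module.End k R) f) :=
  (hφ.exists_ext n P.2).choose_spec.2 f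

theorem resOp_eq (hφ : IsLoc φ x) {n j : ℕ} (P : diffOp k R n) {S : Module.End k B}
    (hS : S ∈ diffOp k B j) (h : ∀ f, S (φ f) = φ ((P : Module.End k R) f)) :
    (resOp hφ n P : Module.End k B) = S :=
  hφ.ext (n := max n j) (diffOp_mono (le_max_left _ _) (resOp hφ n P).2)
    (diffOp_mono (le_max_right _ _) hS) fun f => by rw [resOp_apply, h]

theorem resOp_mem (hφ : IsLoc φ x) {n j : ℕ} (P : diffOp k R n)
    (hP : (P : Module.End k R) ∈ diffOp k R j) :
    (resOp hφ n P : Module.End k B) ∈ diffOp k B j := by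
  rw [resOp_eq hφ P (resOp hφ j ⟨P, hP⟩).2 fun f => resOp_apply hφ j ⟨P, hP⟩ f]
  exact (resOp hφ j ⟨P, hP⟩).2

end Restrict

/-! ### Operators of level `m` -/

section DLevel

variable (k R : Type*) [CommRing k] [CommRing R] [Algebra k R] (p m : ℕ)

/-- The algebra `𝒟^(m)` of the affine scheme `Spec R` over `k`. -/
abbrev DLevel : Type _ := LevelAlg p m (diffOp k R)

variable {k R} in
/-- The class in `𝒟^(m)` of a differential operator of order `≤ 2 p ^ m - 1`. -/
def opOf (P : Module.End k R) (hP : P ∈ diffOp k R (2 * p ^ m - 1)) : DLevel k R p m :=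
  LevelAlg.of ⟨P, hP⟩

variable {k R p m}

theorem opOf_congr {P Q : Module.End k R} (h : P = Q) (hP : P ∈ diffOp k R (2 * p ^ m - 1)) :
    opOf p m P hP = opOf p m Q (h ▸ hP) := by
  subst h; rfl

theorem opOf_add {P Q : Module.End k R} (hP : P ∈ diffOp k R (2 * p ^ m - 1))
    (hQ : Q ∈ diffOp k R (2 * p ^ m - 1)) :
    opOf p m (P + Q) (add_mem hP hQ) = opOf p m P hP + opOf p m Q hQ :=
  map_add LevelAlg.of (⟨P, hP⟩ : diffOp k R (2 * p ^ m - 1)) ⟨Q, hQ⟩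

theorem opOf_sub {P Q : Module.End k R} (hP : P ∈ diffOp k R (2 * p ^ m - 1))
    (hQ : Q ∈ diffOp k R (2 * p ^ m - 1)) :
    opOf p m (P - Q) (sub_mem hP hQ) = opOf p m P hP - opOf p m Q hQ :=
  map_sub LevelAlg.of (⟨P, hP⟩ : diffOp k R (2 * p ^ m - 1)) ⟨Q, hQ⟩

theorem opOf_sum {ι : Type*} (s : Finset ι) {P : ι → Module.End k R}
    (hP : ∀ i, P i ∈ diffOp k R (2 * p ^ m - 1)) :
    opOf p m (∑ i ∈ s, P i) (sum_mem fun i _ => hP i) = ∑ i ∈ s, opOf p m (P i) (hP i) := by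
  unfold opOf
  rw [← map_sum]
  congr 1
  ext1
  simp

theorem opOf_mul {P Q : Module.End k R} (hP : P ∈ diffOp k R (2 * p ^ m - 1))
    (hQ : Q ∈ diffOp k R (2 * p ^ m - 1)) (h1 : P ∈ diffOp k R (p ^ m))
    (h2 : Q ∈ diffOp k R (p ^ m - 1)) (hPQ : P * Q ∈ diffOp k R (2 * p ^ m - 1)) :
    opOf p m P hP * opOf p m Q hQ = opOf p m (P * Q) hPQ :=
  LevelAlg.of_mul ⟨P, hP⟩ ⟨Q, hQ⟩ ⟨P * Q, hPQ⟩ h1 h2 rfl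

theorem opOf_comm {P Q : Module.End k R} (hP : P ∈ diffOp k R (2 * p ^ m - 1))
    (hQ : Q ∈ diffOp k R (2 * p ^ m - 1)) (h1 : P ∈ diffOp k R (p ^ m))
    (h2 : Q ∈ diffOp k R (p ^ m)) (hPQ : P * Q - Q * P ∈ diffOp k R (2 * p ^ m - 1)) :
    opOf p m P hP * opOf p m Q hQ - opOf p m Q hQ * opOf p m P hP
      = opOf p m (P * Q - Q * P) hPQ :=
  LevelAlg.of_comm ⟨P, hP⟩ ⟨Q, hQ⟩ ⟨P * Q - Q * P, hPQ⟩ h1 h2 rfl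

theorem opOf_mul' {P Q : Module.End k R} (hP : P ∈ diffOp k R (2 * p ^ m - 1))
    (hQ : Q ∈ diffOp k R (2 * p ^ m - 1)) (h1 : P ∈ diffOp k R (p ^ m - 1))
    (h2 : Q ∈ diffOp k R (p ^ m)) (hPQ : P * Q ∈ diffOp k R (2 * p ^ m - 1)) :
    opOf p m P hP * opOf p m Q hQ = opOf p m (P * Q) hPQ := by
  have hQP : Q * P ∈ diffOp k R (2 * p ^ m - 1) :=
    diffOp_mono (by omega) (mul_mem_diffOp _ _ _ rfl h2 h1)
  have e := opOf_comm hP hQ (diffOp_mono (by omega) h1) h2 (sub_mem hPQ hQP)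
  rw [opOf_mul hQ hP h2 h1 hQP, opOf_sub hPQ hQP] at e
  exact sub_left_injective e

variable (k R p m) in
/-- Functions, as elements of `𝒟^(m)`. -/
def fnHom : R →+* DLevel k R p m where
  toFun f := opOf p m (Algebra.lmul k R f) (diffOp_mono (Nat.zero_le _) (lmul_mem f))
  map_one' := by
    rw [opOf_congr (map_one _)]
    exact (LevelAlg.of_scalar (1 : k) _ (by simp)).trans (map_one _)
  map_zero' := by
    rw [opOf_congr (map_zero _)]
    exact map_zero LevelAlg.of
  map_add' f g := by
    rw [opOf_congr (map_add _ f g), opOf_add]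
  map_mul' f g := by
    rw [opOf_congr (map_mul _ f g), opOf_mul]
    · exact diffOp_mono (Nat.zero_le _) (lmul_mem f)
    · exact diffOp_mono (Nat.zero_le _) (lmul_mem g)

/-- The structure of left module over the functions. -/
instance instModuleDLevel : Module R (DLevel k R p m) := Module.compHom _ (fnHom k R p m)

theorem fn_smul_def (f : R) (P : DLevel k R p m) : f • P = fnHom k R p m f * P := rfl

theorem fnHom_apply (f : R) : fnHom k R p m f =
  opOf p m (Algebra.lmul k R f) (diffOp_mono (Nat.zero_le _) (lmul_mem f)) := rfl

end DLevel

/-! ### Inverse image by Frobenius -/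

section Frob

variable (p m : ℕ) [Fact p.Prime] (R : Type*) [CommRing R] [CharP R p]

/-- The ring `R`, seen as an `R`-module by means of the Frobenius `f ↦ f ^ p`. -/
def FrobTwist (_ : ℕ) (R : Type*) : Type _ := R

instance : AddCommGroup (FrobTwist p R) := inferInstanceAs (AddCommGroup R)

instance : Module R (FrobTwist p R) := Module.compHom R (frobenius R p)

variable {R} in
/-- A function, as an element of the twisted module. -/
def toTwist (r : R) : FrobTwist p R := r

theorem twist_smul (f r : R) : f • toTwist p r = toTwist p (f ^ p * r) := rfl

/-- The sections over the affine scheme `Spec R` of the inverse image `F^* 𝒟^(m)` by the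
Frobenius, that is `R ⊗ 𝒟^(m)` with `r f ^ p ⊗ P = r ⊗ f P`. -/
abbrev FrobPull [Algebra (ZMod p) R] : Type _ := FrobTwist p R ⊗[R] DLevel (ZMod p) R p m

end Frob

section Coord

variable (p : ℕ) [Fact p.Prime] {R : Type*} [CommRing R] [CharP R p] [Algebra (ZMod p) R]

/-- The map `(c_i)_{0 ≤ i < p} ↦ ∑ x ^ i c_i ^ p`. -/
def frobSum (x : R) : (Fin p → R) →ₗ[ZMod p] R :=
  AddMonoidHom.toZModLinearMap p
    { toFun := fun c => ∑ i : Fin p, x ^ (i : ℕ) * c i ^ p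
      map_zero' := by simp [(Fact.out : p.Prime).ne_zero]
      map_add' := fun c d => by simp [add_pow_char, mul_add, Finset.sum_add_distrib] }

theorem frobSum_apply (x : R) (c : Fin p → R) : frobSum p x c = ∑ i : Fin p, x ^ (i : ℕ) * c i ^ p := rfl

/-- `x` is a global coordinate of `Spec R` over the prime field: its powers `x ^ i`, `0 ≤ i < p`,
form a basis of `R` over `R ^ p`, the functions are generated by `x` and by inverses, and there
are divided powers of the derivation with respect to `x`. -/
structure IsCoord (x : R) : Prop where
  basis : Function.Bijective (frobSum p x)
  gen : ∀ A : Subalgebra (ZMod p) R, x ∈ A → (∀ a b, a * b = 1 → a ∈ A → b ∈ A) → A = ⊤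
  hasse : ∃ d : ℕ → Module.End (ZMod p) R, d 0 = 1 ∧
    (∀ n, ad (ZMod p) R x (d (n + 1)) = d n) ∧ ∀ n, d (n + 1) 1 = 0

variable {p} {x : R}

namespace IsCoord

/-- The components of a function in the basis of the `x ^ i`, `0 ≤ i < p`, over `R ^ p`. -/
def coef (hx : IsCoord p x) : R ≃ₗ[ZMod p] (Fin p → R) :=
  (LinearEquiv.ofBijective (frobSum p x) hx.basis).symm

theorem sum_coef (hx : IsCoord p x) (r : R) : ∑ i : Fin p, x ^ (i : ℕ) * hx.coef r i ^ p = r :=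
  (LinearEquiv.ofBijective (frobSum p x) hx.basis).apply_symm_apply r

theorem coef_sum (hx : IsCoord p x) (c : Fin p → R) :
    hx.coef (∑ i : Fin p, x ^ (i : ℕ) * c i ^ p) = c :=
  (LinearEquiv.ofBijective (frobSum p x) hx.basis).symm_apply_apply c

theorem coef_eq (hx : IsCoord p x) {r : R} {c : Fin p → R}
    (h : ∑ i : Fin p, x ^ (i : ℕ) * c i ^ p = r) : hx.coef r = c := by
  rw [← h, coef_sum]

theorem coef_pow_mul (hx : IsCoord p x) (f r : R) (i : Fin p) :
    hx.coef (f ^ p * r) i = f * hx.coef r i := by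
  have : hx.coef (f ^ p * r) = fun i => f * hx.coef r i := by
    apply hx.coef_eq
    conv_rhs => rw [← hx.sum_coef r]
    rw [Finset.mul_sum]
    exact Finset.sum_congr rfl fun i _ => by rw [mul_pow, mul_left_comm]
  rw [this]

theorem coef_basis (hx : IsCoord p x) (j : Fin p) (r : R) :
    hx.coef (x ^ (j : ℕ) * r ^ p) = Pi.single j r := by
  apply hx.coef_eq
  rw [Finset.sum_eq_single j]
  · simp
  · intro i _ hi
    simp [Pi.single_eq_of_ne hi, (Fact.out : p.Prime).ne_zero]
  · simp

/-- The entries `P_ij` of an operator `P`: `P (x ^ j h ^ p) = ∑ x ^ i (P_ij h) ^ p`. -/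
def entry (hx : IsCoord p x) (P : Module.End (ZMod p) R) (i j : Fin p) : Module.End (ZMod p) R :=
  LinearMap.proj i ∘ₗ hx.coef.toLinearMap ∘ₗ P ∘ₗ Algebra.lmul (ZMod p) R (x ^ (j : ℕ)) ∘ₗ
    AddMonoidHom.toZModLinearMap p (frobenius R p : R →+* R).toAddMonoidHom

variable (hx : IsCoord p x)

theorem entry_apply (P : Module.End (ZMod p) R) (i j : Fin p) (h : R) :
    hx.entry P i j h = hx.coef (P (x ^ (j : ℕ) * h ^ p)) i := rfl

theorem sum_entry (P : Module.End (ZMod p) R) (j : Fin p) (h : R) :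
    ∑ i : Fin p, x ^ (i : ℕ) * (hx.entry P i j h) ^ p = P (x ^ (j : ℕ) * h ^ p) := by
  simp only [entry_apply]
  rw [sum_coef]

theorem entry_eq {P : Module.End (ZMod p) R} {j : Fin p} (E : Fin p → Module.End (ZMod p) R)
    (h : ∀ r, P (x ^ (j : ℕ) * r ^ p) = ∑ i : Fin p, x ^ (i : ℕ) * (E i r) ^ p) (i : Fin p) :
    hx.entry P i j = E i := by
  ext r
  rw [entry_apply, h, coef_sum hx (fun i => E i r)]

theorem entry_add (P Q : Module.End (ZMod p) R) (i j : Fin p) :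
    hx.entry (P + Q) i j = hx.entry P i j + hx.entry Q i j := by
  ext h; simp [entry_apply]

theorem entry_sub (P Q : Module.End (ZMod p) R) (i j : Fin p) :
    hx.entry (P - Q) i j = hx.entry P i j - hx.entry Q i j := by
  ext h; simp [entry_apply]

theorem entry_smul (c : ZMod p) (P : Module.End (ZMod p) R) (i j : Fin p) :
    hx.entry (c • P) i j = c • hx.entry P i j := by
  ext h; simp [entry_apply]

theorem entry_zero (i j : Fin p) : hx.entry 0 i j = 0 := by
  ext h; simp [entry_apply]

theorem entry_one (i j : Fin p) : hx.entry 1 i j = if i = j then 1 else 0 := by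
  ext h
  rw [entry_apply, Module.End.one_apply, coef_basis]
  rw [Pi.single_apply]
  split_ifs <;> rfl

theorem entry_mul (P Q : Module.End (ZMod p) R) (i j : Fin p) :
    hx.entry (P * Q) i j = ∑ l, hx.entry P i l * hx.entry Q l j := by
  refine hx.entry_eq (fun i => ∑ l, hx.entry P i l * hx.entry Q l j) (fun r => ?_) i
  simp only [LinearMap.sum_apply, Module.End.mul_apply]
  rw [← hx.sum_entry Q, map_sum]
  simp_rw [← hx.sum_entry P, sum_pow_char, Finset.mul_sum]
  exact Finset.sum_comm

theorem entry_lmul_pow (f : R) (i j : Fin p) :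
    hx.entry (Algebra.lmul (ZMod p) R (f ^ p)) i j =
      if i = j then Algebra.lmul (ZMod p) R f else 0 := by
  refine hx.entry_eq (fun i => if i = j then Algebra.lmul (ZMod p) R f else 0) (fun r => ?_) i
  rw [Finset.sum_eq_single j]
  · simp [mul_pow, mul_left_comm]
  · intro i _ hi
    simp [hi, (Fact.out : p.Prime).ne_zero]
  · simp

theorem entry_mul_lmul_pow (P : Module.End (ZMod p) R) (f : R) (i j : Fin p) :
    hx.entry (P * Algebra.lmul (ZMod p) R (f ^ p)) i j =
      hx.entry P i j * Algebra.lmul (ZMod p) R f := by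
  rw [entry_mul, Finset.sum_eq_single j]
  · rw [entry_lmul_pow, if_pos rfl]
  · intro l _ hl
    rw [entry_lmul_pow, if_neg hl, mul_zero]
  · simp

theorem entry_lmul_pow_mul (P : Module.End (ZMod p) R) (f : R) (i j : Fin p) :
    hx.entry (Algebra.lmul (ZMod p) R (f ^ p) * P) i j =
      Algebra.lmul (ZMod p) R f * hx.entry P i j := by
  rw [entry_mul, Finset.sum_eq_single i]
  · rw [entry_lmul_pow, if_pos rfl]
  · intro l _ hl
    rw [entry_lmul_pow, if_neg (Ne.symm hl), zero_mul]
  · simp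

theorem entry_ad (P : Module.End (ZMod p) R) (f : R) (i j : Fin p) :
    hx.entry (ad (ZMod p) R (f ^ p) P) i j = ad (ZMod p) R f (hx.entry P i j) := by
  rw [ad_apply, ad_apply, entry_sub, entry_mul_lmul_pow, entry_lmul_pow_mul]

theorem ad_pow (f : R) : ad (ZMod p) R (f ^ p) = ad (ZMod p) R f ^ p := by
  have hR : Nontrivial R := CharP.nontrivial_of_char_ne_one (v := p) (Fact.out : p.Prime).ne_one
  have : CharP (Module.End (ZMod p) (Module.End (ZMod p) R)) p :=
    charP_of_injective_algebraMap (FaithfulSMul.algebraMap_injective (ZMod p) _) p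
  unfold ad
  have h := sub_pow_char_of_commute (R := Module.End (ZMod p) (Module.End (ZMod p) R)) p
    (LinearMap.commute_mulLeft_right (Algebra.lmul (ZMod p) R f)
      (Algebra.lmul (ZMod p) R f)).symm
  rw [LinearMap.pow_mulLeft, LinearMap.pow_mulRight, ← map_pow] at h
  exact h.symm

theorem ad_iter_mem (f : R) {P : Module.End (ZMod p) R} : ∀ (j n : ℕ), P ∈ diffOp (ZMod p) R (n + j) →
    (ad (ZMod p) R f ^ j) P ∈ diffOp (ZMod p) R n := by
  intro j
  induction j with
  | zero => intro n h; simpa using h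
  | succ j ih =>
    intro n h
    rw [pow_succ', Module.End.mul_apply]
    refine mem_diffOp_succ.1 (ih (n + 1) (by rwa [add_assoc, add_comm 1])) f

theorem ad_iter_zero (f : R) {P : Module.End (ZMod p) R} (j n : ℕ) (hjn : n < j)
    (h : P ∈ diffOp (ZMod p) R n) : (ad (ZMod p) R f ^ j) P = 0 := by
  obtain ⟨i, rfl⟩ := Nat.exists_eq_add_of_lt hjn
  have h1 := ad_iter_mem f n 0 (by simpa using h)
  rw [show n + i + 1 = i + (1 + n) by ring, pow_add, pow_add, Module.End.mul_apply,
    Module.End.mul_apply, pow_one, mem_diffOp_zero.1 h1 f, map_zero]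

theorem entry_mem : ∀ (n q : ℕ), n / p = q → ∀ {P : Module.End (ZMod p) R},
    P ∈ diffOp (ZMod p) R n → ∀ i j : Fin p, hx.entry P i j ∈ diffOp (ZMod p) R q := by
  intro n q
  have hp := (Fact.out : p.Prime).pos
  induction q generalizing n with
  | zero =>
    intro hn P hP i j
    rw [mem_diffOp_zero]
    intro f
    rw [← entry_ad, ad_pow, ad_iter_zero f p n _ hP, entry_zero]
    exact (Nat.div_eq_zero_iff_lt hp).1 hn
  | succ q ih =>
    intro hn P hP i j
    rw [mem_diffOp_succ]
    intro f
    have hpn : p ≤ n := by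
      by_contra h
      rw [Nat.div_eq_of_lt (by omega)] at hn
      omega
    rw [← entry_ad, ad_pow]
    refine ih (n - p) ?_ (ad_iter_mem f p (n - p) (by rwa [Nat.sub_add_cancel hpn])) i j
    rw [Nat.div_eq_sub_div hp hpn] at hn
    omega
end IsCoord
end Coord

section Coord2
variable {p : ℕ} [Fact p.Prime] {R : Type*} [CommRing R] [CharP R p] [Algebra (ZMod p) R] {x : R}
namespace IsCoord
variable (hx : IsCoord p x)

/-- The divided powers of the derivation with respect to a coordinate. -/
def hasseD (n : ℕ) : Module.End (ZMod p) R := hx.hasse.choose n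


theorem hasseD_zero : hx.hasseD 0 = 1 := hx.hasse.choose_spec.1

theorem ad_hasseD (n : ℕ) : ad (ZMod p) R x (hx.hasseD (n + 1)) = hx.hasseD n :=
  hx.hasse.choose_spec.2.1 n

theorem hasseD_one (n : ℕ) : hx.hasseD (n + 1) 1 = 0 := hx.hasse.choose_spec.2.2 n

theorem mem_zero_of_ad (hx : IsCoord p x)
    {P : Module.End (ZMod p) R} (h : ad (ZMod p) R x P = 0) :
    P ∈ diffOp (ZMod p) R 0 := by
  have h1 : ∀ c : ZMod p, ad (ZMod p) R (algebraMap (ZMod p) R c) P = 0 := fun c => by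
    ext r
    simp [ad_apply_apply, ← Algebra.smul_def]
  have hA := hx.gen
    { carrier := {f | ad (ZMod p) R f P = 0}
      mul_mem' := fun {a b} ha hb => by
        rw [Set.mem_ofPred_eq] at *
        rw [ad_mul_left, ha, hb, zero_mul, mul_zero, add_zero]
      add_mem' := fun {a b} ha hb => by
        rw [Set.mem_ofPred_eq] at *
        rw [ad_apply, map_add, mul_add, add_mul, add_sub_add_comm, ← ad_apply, ← ad_apply, ha, hb,
          add_zero]
      algebraMap_mem' := h1 } h (fun a b hab ha => by
        have h2 := h1 1
        rw [map_one, ← hab, ad_mul_left, show ad (ZMod p) R a P = 0 from ha, zero_mul,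
          zero_add] at h2
        have h3 := congrArg (Algebra.lmul (ZMod p) R b * ·) h2
        simp only [mul_zero] at h3
        rwa [← mul_assoc, ← map_mul, mul_comm b, hab, map_one, one_mul] at h3)
  exact mem_diffOp_zero.2 fun f => (hA ▸ Algebra.mem_top : f ∈ _)

theorem mem_succ_of_ad (hx : IsCoord p x)
    : ∀ (n : ℕ) {P : Module.End (ZMod p) R},
    ad (ZMod p) R x P ∈ diffOp (ZMod p) R n → P ∈ diffOp (ZMod p) R (n + 1) := by
  intro n
  induction n with
  | zero =>
    intro P h
    rw [mem_diffOp_succ]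
    intro f
    apply hx.mem_zero_of_ad
    rw [ad_comm, mem_diffOp_zero.1 h f]
  | succ n ih =>
    intro P h
    rw [mem_diffOp_succ]
    intro f
    apply ih
    rw [ad_comm]
    exact mem_diffOp_succ.1 h f

theorem hasseD_mem (n : ℕ) : hx.hasseD n ∈ diffOp (ZMod p) R n := by
  induction n with
  | zero =>
    rw [hasseD_zero, ← map_one (Algebra.lmul (ZMod p) R)]
    exact lmul_mem 1
  | succ n ih => exact hx.mem_succ_of_ad n (by rwa [ad_hasseD])

theorem exists_leading (hx : IsCoord p x)
    : ∀ (n : ℕ) {P : Module.End (ZMod p) R}, P ∈ diffOp (ZMod p) R (n + 1) →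
    ∃ f, P - Algebra.lmul (ZMod p) R f * hx.hasseD (n + 1) ∈ diffOp (ZMod p) R n := by
  intro n
  induction n with
  | zero =>
    intro P h
    have h1 := mem_diffOp_succ.1 h x
    refine ⟨ad (ZMod p) R x P 1, hx.mem_zero_of_ad ?_⟩
    rw [map_sub, ad_lmul_mul, ad_hasseD, hasseD_zero, mul_one, ← eq_lmul h1, sub_self]
  | succ n ih =>
    intro P h
    obtain ⟨f, hf⟩ := ih (mem_diffOp_succ.1 h x)
    refine ⟨f, hx.mem_succ_of_ad n ?_⟩
    rwa [map_sub, ad_lmul_mul, ad_hasseD]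

theorem ad_pow_hasseD (j n : ℕ) : (ad (ZMod p) R x ^ j) (hx.hasseD n) =
    if j ≤ n then hx.hasseD (n - j) else 0 := by
  induction j with
  | zero => simp
  | succ j ih =>
    rw [pow_succ', Module.End.mul_apply, ih]
    rcases lt_trichotomy j n with h | h | h
    · rw [if_pos h.le, if_pos (Nat.succ_le_of_lt h), show n - j = n - (j + 1) + 1 by omega, ad_hasseD]
    · subst h
      rw [if_pos le_rfl, if_neg (by omega), Nat.sub_self, hasseD_zero, ← map_one (Algebra.lmul (ZMod p) R)]
      exact mem_diffOp_zero.1 (lmul_mem 1) x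
    · rw [if_neg (by omega), if_neg (by omega), map_zero]

/-- An operator which commutes with the coordinate and kills `1` is zero. -/
theorem eq_of_ad (hx : IsCoord p x)
    {P Q : Module.End (ZMod p) R} (h : ad (ZMod p) R x P = ad (ZMod p) R x Q)
    (h1 : P 1 = Q 1) : P = Q := by
  have h0 : P - Q ∈ diffOp (ZMod p) R 0 := hx.mem_zero_of_ad (by rw [map_sub, h, sub_self])
  have := eq_lmul h0
  rw [LinearMap.sub_apply, h1, sub_self, map_zero] at this
  exact sub_eq_zero.1 this

theorem entry_hasseD_col_zero (h0 : 0 < p) (n : ℕ) : ∀ i : Fin p,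
    hx.entry (hx.hasseD n) i ⟨0, h0⟩ =
      if i = ⟨0, h0⟩ ∧ p ∣ n then hx.hasseD (n / p) else 0 := by
  induction n using Nat.strong_induction_on with
  | _ n ih =>
  intro i
  rcases Nat.eq_zero_or_pos n with rfl | hn
  · rw [hasseD_zero, entry_one, Nat.zero_div, hasseD_zero]
    exact if_congr (by simp) rfl rfl
  apply hx.eq_of_ad
  · rw [← entry_ad, ad_pow, ad_pow_hasseD]
    split_ifs with h1 h2 h2
    · rw [ih _ (by omega), if_pos ⟨h2.1, Nat.dvd_sub h2.2 dvd_rfl⟩]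
      rw [Nat.div_eq_sub_div h0 h1, ad_hasseD]
    · rw [ih _ (by omega), if_neg, map_zero]
      rintro ⟨h3, h4⟩
      exact h2 ⟨h3, by simpa [Nat.sub_add_cancel h1] using Nat.dvd_add h4 dvd_rfl⟩
    · exact absurd (Nat.le_of_dvd hn h2.2) h1
    · rw [entry_zero, map_zero]
  · obtain ⟨n, rfl⟩ := Nat.exists_eq_succ_of_ne_zero hn.ne'
    rw [entry_apply, one_pow, mul_one, pow_zero, hasseD_one, map_zero]
    split_ifs with h
    · obtain ⟨q, hq⟩ := Nat.exists_eq_succ_of_ne_zero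
        (Nat.div_pos (Nat.le_of_dvd hn h.2) h0).ne'
      rw [hq, hasseD_one]; rfl
    · rfl

theorem hasseD_frob (n : ℕ) (h : R) :
    hx.hasseD n (h ^ p) = if p ∣ n then (hx.hasseD (n / p) h) ^ p else 0 := by
  have h0 := (Fact.out : p.Prime).pos
  have := hx.sum_entry (hx.hasseD n) ⟨0, h0⟩ h
  rw [pow_zero, one_mul] at this
  rw [← this]
  simp_rw [hx.entry_hasseD_col_zero h0]
  rw [Finset.sum_eq_single ⟨0, h0⟩]
  · split_ifs with h1 h2 h2
    · simp
    · exact absurd h1.2 h2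
    · exact absurd ⟨rfl, h2⟩ h1
    · simp [h0.ne']
  · intro i _ hi
    rw [if_neg (fun h => hi h.1)]
    simp [h0.ne']
  · simp

theorem hasseD_mul (n : ℕ) (h : R) :
    hx.hasseD (n + 1) (x * h) = x * hx.hasseD (n + 1) h + hx.hasseD n h := by
  rw [← hx.ad_hasseD n, ad_apply_apply]; ring

theorem hasseD_basis (h : R) (j : ℕ) : j < p → ∀ n : ℕ,
    (p ∣ n → hx.hasseD n (x ^ j * h ^ p) = x ^ j * (hx.hasseD (n / p) h) ^ p) ∧
    (j < n % p → hx.hasseD n (x ^ j * h ^ p) = 0) := by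
  induction j with
  | zero =>
    intro _ n
    rw [pow_zero, one_mul, one_mul, hasseD_frob]
    refine ⟨fun h => if_pos h, fun h => if_neg fun h' => ?_⟩
    rw [Nat.mod_eq_zero_of_dvd h'] at h
    omega
  | succ j ih =>
    intro hj n
    have ih := ih (by omega)
    rw [pow_succ', mul_assoc]
    cases n with
    | zero => simp [hasseD_zero, mul_assoc]
    | succ n =>
      rw [hasseD_mul]
      constructor
      · intro hd
        rw [(ih _).1 hd, (ih n).2, add_zero, mul_assoc]
        obtain ⟨q, hq⟩ := hd
        obtain ⟨q, rfl⟩ := Nat.exists_eq_succ_of_ne_zero (n := q) (by rintro rfl; simp at hq)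
        rw [show n = (p - 1) + p * q by rw [Nat.mul_succ] at hq; omega, Nat.add_mul_mod_self_left,
          Nat.mod_eq_of_lt (by omega)]
        omega
      · intro hlt
        have : n % p = (n + 1) % p - 1 := by
          have h1 := Nat.add_mod n 1 p
          have h2 := Nat.mod_lt n (Fact.out : p.Prime).pos
          have h3 := Nat.mod_eq_of_lt (Fact.out : p.Prime).one_lt
          rw [h3] at h1
          rcases Nat.lt_or_ge (n % p + 1) p with h4 | h4
          · rw [Nat.mod_eq_of_lt h4] at h1; omega
          · rw [show n % p + 1 = p by omega, Nat.mod_self] at h1; omega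
        rw [(ih _).2 (by omega), (ih n).2 (by omega), mul_zero, add_zero]

theorem entry_hasseD (n : ℕ) (i j : Fin p) :
    hx.entry (hx.hasseD (p * n)) i j = if i = j then hx.hasseD n else 0 := by
  have h0 := (Fact.out : p.Prime).pos
  refine hx.entry_eq (fun i => if i = j then hx.hasseD n else 0) (fun r => ?_) i
  rw [((hx.hasseD_basis r j j.2) (p * n)).1 ⟨n, rfl⟩, Finset.sum_eq_single j]
  · rw [if_pos rfl, Nat.mul_div_cancel_left _ h0]
  · intro i _ hi
    rw [if_neg hi]
    simp [h0.ne']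
  · simp

theorem div_level (m : ℕ) : (2 * p ^ (m + 1) - 1) / p = 2 * p ^ m - 1 ∧
    p ^ (m + 1) / p = p ^ m ∧ (p ^ (m + 1) - 1) / p = p ^ m - 1 := by
  have h0 := (Fact.out : p.Prime).pos
  have h1 : 0 < p ^ m := pow_pos h0 m
  have key : ∀ a, 0 < a → (p * a - 1) / p = a - 1 := by
    intro a ha
    obtain ⟨b, rfl⟩ := Nat.exists_eq_succ_of_ne_zero ha.ne'
    rw [show p * (b + 1) - 1 = (p - 1) + p * b by rw [mul_add]; omega, Nat.add_mul_div_left _ _ h0,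
      Nat.div_eq_of_lt (by omega)]
    omega
  refine ⟨?_, ?_, ?_⟩
  · rw [pow_succ', ← mul_left_comm, key _ (by omega)]
  · rw [pow_succ', Nat.mul_div_cancel_left _ h0]
  · rw [pow_succ', key _ h1]

end IsCoord
end Coord2

section Coord3
variable {p m : ℕ} [Fact p.Prime] {R : Type*} [CommRing R] [CharP R p] [Algebra (ZMod p) R] {x : R}
namespace IsCoord
variable (hx : IsCoord p x)

variable (m) in
/-- The matrix of the entries of an operator of order `≤ 2 p ^ (m + 1) - 1`, in `𝒟^(m)`. -/
def mat : diffOp (ZMod p) R (2 * p ^ (m + 1) - 1) →ₗ[ZMod p]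
    Matrix (Fin p) (Fin p) (DLevel (ZMod p) R p m) where
  toFun P := Matrix.of fun i j =>
    opOf p m (hx.entry P i j) (hx.entry_mem _ _ (div_level m).1 P.2 i j)
  map_add' P Q := by
    ext i j
    exact (opOf_congr (hx.entry_add P Q i j) _).trans (opOf_add _ _)
  map_smul' c P := by
    ext i j
    exact (opOf_congr (hx.entry_smul c P i j) _).trans
      (map_smul LevelAlg.of c (⟨_, hx.entry_mem _ _ (div_level m).1 P.2 i j⟩ :
        diffOp (ZMod p) R (2 * p ^ m - 1)))

theorem mat_apply (P : diffOp (ZMod p) R (2 * p ^ (m + 1) - 1)) (i j : Fin p) :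
    hx.mat m P i j = opOf p m (hx.entry P i j) (hx.entry_mem _ _ (div_level m).1 P.2 i j) := rfl

theorem mat_mul (P Q S : diffOp (ZMod p) R (2 * p ^ (m + 1) - 1))
    (hP : (P : Module.End (ZMod p) R) ∈ diffOp (ZMod p) R (p ^ (m + 1)))
    (hQ : (Q : Module.End (ZMod p) R) ∈ diffOp (ZMod p) R (p ^ (m + 1) - 1))
    (hS : (S : Module.End (ZMod p) R) = P * Q) : hx.mat m P * hx.mat m Q = hx.mat m S := by
  ext i j
  rw [Matrix.mul_apply]
  have hP' := hx.entry_mem _ _ (div_level m).2.1 hP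
  have hQ' := hx.entry_mem _ _ (div_level m).2.2 hQ
  have hPQ : ∀ l, hx.entry P i l * hx.entry Q l j ∈ diffOp (ZMod p) R (2 * p ^ m - 1) := fun l =>
    diffOp_mono (by omega) (mul_mem_diffOp _ _ _ rfl (hP' i l) (hQ' l j))
  simp_rw [mat_apply]
  rw [opOf_congr ((congrArg (hx.entry · i j) hS).trans (hx.entry_mul P Q i j)), opOf_sum _ hPQ]
  exact Finset.sum_congr rfl fun l _ => opOf_mul _ _ (hP' i l) (hQ' l j) (hPQ l)

theorem mat_mul' (P Q S : diffOp (ZMod p) R (2 * p ^ (m + 1) - 1))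
    (hP : (P : Module.End (ZMod p) R) ∈ diffOp (ZMod p) R (p ^ (m + 1) - 1))
    (hQ : (Q : Module.End (ZMod p) R) ∈ diffOp (ZMod p) R (p ^ (m + 1)))
    (hS : (S : Module.End (ZMod p) R) = P * Q) : hx.mat m P * hx.mat m Q = hx.mat m S := by
  ext i j
  rw [Matrix.mul_apply]
  have hP' := hx.entry_mem _ _ (div_level m).2.2 hP
  have hQ' := hx.entry_mem _ _ (div_level m).2.1 hQ
  have hPQ : ∀ l, hx.entry P i l * hx.entry Q l j ∈ diffOp (ZMod p) R (2 * p ^ m - 1) := fun l =>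
    diffOp_mono (by omega) (mul_mem_diffOp _ _ _ rfl (hP' i l) (hQ' l j))
  simp_rw [mat_apply]
  rw [opOf_congr ((congrArg (hx.entry · i j) hS).trans (hx.entry_mul P Q i j)), opOf_sum _ hPQ]
  exact Finset.sum_congr rfl fun l _ => opOf_mul' _ _ (hP' i l) (hQ' l j) (hPQ l)

theorem mat_comm_leading (d : Module.End (ZMod p) R) (hd : d ∈ diffOp (ZMod p) R (p ^ (m + 1)))
    (f g : R) (P Q S : diffOp (ZMod p) R (2 * p ^ (m + 1) - 1))
    (hP : (P : Module.End (ZMod p) R) = Algebra.lmul (ZMod p) R f * d)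
    (hQ : (Q : Module.End (ZMod p) R) = Algebra.lmul (ZMod p) R g * d)
    (hS : (S : Module.End (ZMod p) R) = P * Q - Q * P) :
    hx.mat m P * hx.mat m Q - hx.mat m Q * hx.mat m P = hx.mat m S := by
  have h1 : 1 < p ^ (m + 1) := Nat.one_lt_pow (by omega) (Fact.out : p.Prime).one_lt
  let F (f : R) : diffOp (ZMod p) R (2 * p ^ (m + 1) - 1) :=
    ⟨Algebra.lmul (ZMod p) R f, diffOp_mono (Nat.zero_le _) (lmul_mem f)⟩
  let δ : diffOp (ZMod p) R (2 * p ^ (m + 1) - 1) := ⟨d, diffOp_mono (by omega) hd⟩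
  have hF (f : R) : (F f : Module.End (ZMod p) R) ∈ diffOp (ZMod p) R (p ^ (m + 1) - 1) :=
    diffOp_mono (Nat.zero_le _) (lmul_mem f)
  have hA (f : R) : ad (ZMod p) R f d ∈ diffOp (ZMod p) R (p ^ (m + 1) - 1) := by
    have : d ∈ diffOp (ZMod p) R (p ^ (m + 1) - 1 + 1) := by rwa [Nat.sub_add_cancel h1.le]
    exact mem_diffOp_succ.1 this f
  let A (f : R) : diffOp (ZMod p) R (2 * p ^ (m + 1) - 1) :=
    ⟨ad (ZMod p) R f d, diffOp_mono (by omega) (hA f)⟩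
  let A' (f g : R) : diffOp (ZMod p) R (2 * p ^ (m + 1) - 1) :=
    ⟨Algebra.lmul (ZMod p) R f * ad (ZMod p) R g d,
      diffOp_mono (by omega) (lmul_mul_mem f (hA g))⟩
  let A'' (f g : R) : diffOp (ZMod p) R (2 * p ^ (m + 1) - 1) :=
    ⟨Algebra.lmul (ZMod p) R f * ad (ZMod p) R g d * d,
      diffOp_mono (by omega) (mul_mem_diffOp _ _ _ rfl (lmul_mul_mem f (hA g)) hd)⟩
  let D (f : R) : diffOp (ZMod p) R (2 * p ^ (m + 1) - 1) :=
    ⟨Algebra.lmul (ZMod p) R f * d, diffOp_mono (by omega) (lmul_mul_mem f hd)⟩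
  let D' (f : R) : diffOp (ZMod p) R (2 * p ^ (m + 1) - 1) :=
    ⟨d * Algebra.lmul (ZMod p) R f, diffOp_mono (by omega) (mul_lmul_mem f hd)⟩
  have e0 (f g : R) : hx.mat m (F f) * hx.mat m (F g) = hx.mat m (F (f * g)) :=
    hx.mat_mul _ _ _ (diffOp_mono (by omega) (hF f)) (hF g)
      (map_mul (Algebra.lmul (ZMod p) R) f g)
  have e1 (f : R) : hx.mat m (F f) * hx.mat m δ = hx.mat m (D f) :=
    hx.mat_mul' _ _ _ (hF f) hd rfl
  have e2 (f : R) : hx.mat m δ * hx.mat m (F f) = hx.mat m (D' f) :=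
    hx.mat_mul _ _ _ hd (hF f) rfl
  have e3 (f : R) : hx.mat m (D' f) = hx.mat m (D f) + hx.mat m (A f) := by
    rw [← map_add]
    congr 1
    ext1
    simp [D, D', A, ad_apply]
  have e4 (f g : R) : hx.mat m (F f) * hx.mat m (A g) = hx.mat m (A' f g) :=
    hx.mat_mul _ _ _ (diffOp_mono (by omega) (hF f)) (hA g) rfl
  have e5 (f g : R) : hx.mat m (A' f g) * hx.mat m δ = hx.mat m (A'' f g) :=
    hx.mat_mul' _ _ _ (lmul_mul_mem f (hA g)) hd rfl
  have e6 (f g : R) : hx.mat m (D f) * hx.mat m (D g) =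
      hx.mat m (F (f * g)) * hx.mat m δ * hx.mat m δ + hx.mat m (A'' f g) := by
    rw [← e1 f, ← e1 g, mul_assoc, ← mul_assoc (hx.mat m δ), e2, e3, add_mul, mul_add,
      ← mul_assoc _ (hx.mat m (A g)), e4, e5, ← e1 g, ← mul_assoc, ← mul_assoc, e0]
  have hPD : P = D f := Subtype.ext hP
  have hQD : Q = D g := Subtype.ext hQ
  have hS' : S = A'' f g - A'' g f := by
    ext1
    rw [hS, hP, hQ]
    ext h
    simp [A'', ad_apply_apply, mul_sub]
    ring
  rw [hPD, hQD, e6, e6, mul_comm g f, hS', (hx.mat m).map_sub]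
  abel

theorem mat_comm (P Q S : diffOp (ZMod p) R (2 * p ^ (m + 1) - 1))
    (hP : (P : Module.End (ZMod p) R) ∈ diffOp (ZMod p) R (p ^ (m + 1)))
    (hQ : (Q : Module.End (ZMod p) R) ∈ diffOp (ZMod p) R (p ^ (m + 1)))
    (hS : (S : Module.End (ZMod p) R) = P * Q - Q * P) :
    hx.mat m P * hx.mat m Q - hx.mat m Q * hx.mat m P = hx.mat m S := by
  have h1 : 1 < p ^ (m + 1) := Nat.one_lt_pow (by omega) (Fact.out : p.Prime).one_lt
  have low : ∀ P Q S : diffOp (ZMod p) R (2 * p ^ (m + 1) - 1),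
      (P : Module.End (ZMod p) R) ∈ diffOp (ZMod p) R (p ^ (m + 1)) →
      (Q : Module.End (ZMod p) R) ∈ diffOp (ZMod p) R (p ^ (m + 1) - 1) →
      (S : Module.End (ZMod p) R) = P * Q - Q * P →
      hx.mat m P * hx.mat m Q - hx.mat m Q * hx.mat m P = hx.mat m S := by
    intro P Q S hP hQ hS
    have a : (P * Q : Module.End (ZMod p) R) ∈ diffOp (ZMod p) R (2 * p ^ (m + 1) - 1) :=
      diffOp_mono (by omega) (mul_mem_diffOp _ _ _ rfl hP hQ)
    have b : (Q * P : Module.End (ZMod p) R) ∈ diffOp (ZMod p) R (2 * p ^ (m + 1) - 1) :=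
      diffOp_mono (by omega) (mul_mem_diffOp _ _ _ rfl hQ hP)
    rw [hx.mat_mul P Q ⟨_, a⟩ hP hQ rfl, hx.mat_mul' Q P ⟨_, b⟩ hQ hP rfl, ← map_sub]
    congr 1
    ext1
    simp [hS]
  obtain ⟨n, hn⟩ : ∃ n, p ^ (m + 1) = n + 1 := ⟨p ^ (m + 1) - 1, by omega⟩
  have hn' : p ^ (m + 1) - 1 = n := by omega
  have hd := hx.hasseD_mem (n + 1)
  rw [← hn] at hd
  obtain ⟨f, hf⟩ := hx.exists_leading n (P := P) (by rwa [← hn])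
  obtain ⟨g, hg⟩ := hx.exists_leading n (P := Q) (by rwa [← hn])
  rw [← hn, ← hn'] at hf hg
  have lift : ∀ {T : Module.End (ZMod p) R}, T ∈ diffOp (ZMod p) R (p ^ (m + 1)) →
    T ∈ diffOp (ZMod p) R (2 * p ^ (m + 1) - 1) := fun h => diffOp_mono (by omega) h
  have low' : ∀ {T : Module.End (ZMod p) R}, T ∈ diffOp (ZMod p) R (p ^ (m + 1) - 1) →
    T ∈ diffOp (ZMod p) R (p ^ (m + 1)) := fun h => diffOp_mono (by omega) h
  have hfd := lmul_mul_mem f hd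
  have hgd := lmul_mul_mem g hd
  let P1 : diffOp (ZMod p) R (2 * p ^ (m + 1) - 1) := ⟨_, lift hfd⟩
  let Q1 : diffOp (ZMod p) R (2 * p ^ (m + 1) - 1) := ⟨_, lift hgd⟩
  let P0 : diffOp (ZMod p) R (2 * p ^ (m + 1) - 1) := ⟨_, lift (low' hf)⟩
  let Q0 : diffOp (ZMod p) R (2 * p ^ (m + 1) - 1) := ⟨_, lift (low' hg)⟩
  have hPe : P = P1 + P0 := by ext1; simp [P1, P0]
  have hQe : Q = Q1 + Q0 := by ext1; simp [Q1, Q0]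
  have mem : ∀ {T U : Module.End (ZMod p) R}, T ∈ diffOp (ZMod p) R (p ^ (m + 1)) →
      U ∈ diffOp (ZMod p) R (p ^ (m + 1) - 1) →
      T * U - U * T ∈ diffOp (ZMod p) R (2 * p ^ (m + 1) - 1) := fun hT hU =>
    sub_mem (diffOp_mono (by omega) (mul_mem_diffOp _ _ _ rfl hT hU))
      (diffOp_mono (by omega) (mul_mem_diffOp _ _ _ rfl hU hT))
  have mem2 := S.2
  let S1 : diffOp (ZMod p) R (2 * p ^ (m + 1) - 1) := ⟨_, mem hP hg⟩
  let S2 : diffOp (ZMod p) R (2 * p ^ (m + 1) - 1) := ⟨_, mem hgd hf⟩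
  have i1 := low P Q0 S1 hP hg rfl
  have i2 := low Q1 P0 S2 hgd hf rfl
  have i3 := hx.mat_comm_leading _ hd f g P1 Q1 (S - S1 + S2) rfl rfl (by
    have a : (P : Module.End (ZMod p) R) = P1 + P0 := congrArg Subtype.val hPe
    have b : (Q : Module.End (ZMod p) R) = Q1 + Q0 := congrArg Subtype.val hQe
    have c : (S1 : Module.End (ZMod p) R) = P * Q0 - Q0 * P := rfl
    have d : (S2 : Module.End (ZMod p) R) = Q1 * P0 - P0 * Q1 := rfl
    rw [Submodule.coe_add, Submodule.coe_sub, c, d, hS, b, a]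
    noncomm_ring)
  rw [(hx.mat m).map_add, (hx.mat m).map_sub, ← i1, ← i2] at i3
  have a : hx.mat m P = hx.mat m P1 + hx.mat m P0 := by rw [← map_add, ← hPe]
  have b : hx.mat m Q = hx.mat m Q1 + hx.mat m Q0 := by rw [← map_add, ← hQe]
  rw [eq_comm, ← sub_eq_zero] at i3
  rw [← sub_eq_zero, ← neg_eq_zero, ← i3, b, a]
  noncomm_ring

/-- The left action of `𝒟^(m+1)` on the inverse image by Frobenius of `𝒟^(m)`, in the basis of the
`x ^ i ⊗ 1`, `0 ≤ i < p`: an operator `P` acts by `x ^ j ⊗ Q ↦ ∑ x ^ i ⊗ P_ij Q`, with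
`P (x ^ j h ^ p) = ∑ x ^ i (P_ij h) ^ p`. -/
def frobAction : DLevel (ZMod p) R p (m + 1) →ₐ[ZMod p]
    Matrix (Fin p) (Fin p) (DLevel (ZMod p) R p m) :=
  LevelAlg.lift (hx.mat m)
    (fun c e he => by
      ext i j
      rw [mat_apply]
      have h1 : hx.entry e i j = algebraMap (ZMod p) _ (if i = j then c else 0) := by
        rw [he, Algebra.algebraMap_eq_smul_one, entry_smul, entry_one]
        split_ifs <;> simp [Algebra.algebraMap_eq_smul_one]
      exact (LevelAlg.of_scalar (if i = j then c else 0) _ h1).trans (by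
        rw [Matrix.algebraMap_matrix_apply]; split_ifs <;> simp))
    (fun D D' e => hx.mat_comm D D' e) (fun D D' e => hx.mat_mul D D' e)

theorem frobAction_of (P : diffOp (ZMod p) R (2 * p ^ (m + 1) - 1)) :
    hx.frobAction (LevelAlg.of P) = hx.mat m P := LevelAlg.lift_of _ _ _ _ P

/-- The canonical map `𝒟^(m+1) → F^* 𝒟^(m)`, `P ↦ P · (1 ⊗ 1)`. -/
def can : DLevel (ZMod p) R p (m + 1) →+ FrobPull p m R where
  toFun P := ∑ i : Fin p, toTwist p (x ^ (i : ℕ)) ⊗ₜ[R]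
    hx.frobAction P i ⟨0, (Fact.out : p.Prime).pos⟩
  map_zero' := by simp
  map_add' P Q := by simp [TensorProduct.tmul_add, Finset.sum_add_distrib]

theorem can_apply (P : DLevel (ZMod p) R p (m + 1)) :
    hx.can P = ∑ i : Fin p, toTwist p (x ^ (i : ℕ)) ⊗ₜ[R]
      hx.frobAction P i ⟨0, (Fact.out : p.Prime).pos⟩ := rfl

end IsCoord
end Coord3

theorem LevelAlg.induction {k A : Type*} [CommRing k] [Ring A] [Algebra k A] {p m : ℕ}
    {Fil : ℕ → Submodule k A} {motive : LevelAlg p m Fil → Prop}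
    (of : ∀ e, motive (LevelAlg.of e)) (scalar : ∀ c, motive (algebraMap k _ c))
    (add : ∀ a b, motive a → motive b → motive (a + b))
    (mul : ∀ a b, motive a → motive b → motive (a * b)) (a : LevelAlg p m Fil) : motive a := by
  obtain ⟨t, rfl⟩ : ∃ t, (RingQuot.mkAlgHom k (LevelRel p m Fil) t : LevelAlg p m Fil) = a :=
    RingQuot.mkAlgHom_surjective k _ a
  induction t using TensorAlgebra.induction with
  | algebraMap c =>
    rw [AlgHom.commutes]
    exact scalar c
  | ι e => exact of e
  | mul a b ha hb =>
    rw [map_mul]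
    exact mul _ _ ha hb
  | add a b ha hb =>
    rw [map_add]
    exact add _ _ ha hb

section Coord4
variable {p m : ℕ} [Fact p.Prime] {R : Type*} [CommRing R] [CharP R p] [Algebra (ZMod p) R] {x y : R}
namespace IsCoord
variable (hx : IsCoord p x) (hy : IsCoord p y)

theorem hasseD_comp : ∀ n a b : ℕ, a + b = n →
    hx.hasseD a * hx.hasseD b = (n.choose b : ZMod p) • hx.hasseD n := by
  intro n
  induction n with
  | zero =>
    intro a b h
    obtain ⟨rfl, rfl⟩ : a = 0 ∧ b = 0 := by omega
    simp [hasseD_zero]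
  | succ n ih =>
    intro a b h
    rcases b with _ | b
    · obtain rfl : a = n + 1 := by omega
      simp [hasseD_zero]
    rcases a with _ | a
    · obtain rfl : b = n := by omega
      simp [hasseD_zero]
    apply hx.eq_of_ad
    · rw [ad_mul, map_smul, ad_hasseD, ad_hasseD, ad_hasseD, ih a (b + 1) (by omega),
        ih (a + 1) b (by omega), ← add_smul, Nat.choose_succ_succ]
      push_cast
      rw [add_comm]
    · simp [hasseD_one]

theorem choose_eq_one (m r : ℕ) (hr : r < p ^ m) : ((p ^ m + r).choose r : ZMod p) = 1 := by
  rw [Nat.add_choose_eq, Nat.cast_sum, Finset.sum_eq_single (0, r)]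
  · simp
  · rintro ⟨i, j⟩ h hne
    replace h := Finset.HasAntidiagonal.mem_antidiagonal.1 h
    have hi : i ≠ 0 := by
      rintro rfl
      exact hne (by simpa using h)
    have : p ∣ (p ^ m).choose i :=
      (Fact.out : p.Prime).dvd_choose_pow hi (by simp at h; omega)
    rw [Nat.cast_mul, (ZMod.natCast_eq_zero_iff _ _).2 this, zero_mul]
  · simp

theorem fn_mul_aux (hx : IsCoord p x)
    : ∀ n : ℕ, n ≤ 2 * p ^ m - 1 → ∀ {P : Module.End (ZMod p) R}
    (h : P ∈ diffOp (ZMod p) R (2 * p ^ m - 1)), P ∈ diffOp (ZMod p) R n → ∀ f : R,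
    fnHom (ZMod p) R p m f * opOf p m P h = opOf p m _ (lmul_mul_mem f h) ∧
    opOf p m P h * fnHom (ZMod p) R p m f = opOf p m _ (mul_lmul_mem f h) := by
  intro n
  have hpm : 0 < p ^ m := pow_pos (Fact.out : p.Prime).pos m
  induction n with
  | zero =>
    intro _ P h hP f
    have hf : Algebra.lmul (ZMod p) R f ∈ diffOp (ZMod p) R 0 := lmul_mem f
    exact ⟨opOf_mul _ _ (diffOp_mono (Nat.zero_le _) hf) (diffOp_mono (Nat.zero_le _) hP) _,
      opOf_mul _ _ (diffOp_mono (Nat.zero_le _) hP) (diffOp_mono (Nat.zero_le _) hf) _⟩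
  | succ n ih =>
    intro hn P h hP f
    have hf : Algebra.lmul (ZMod p) R f ∈ diffOp (ZMod p) R 0 := lmul_mem f
    by_cases hle : n + 1 ≤ p ^ m
    · exact ⟨opOf_mul' _ _ (diffOp_mono (Nat.zero_le _) hf) (diffOp_mono hle hP) _,
        opOf_mul _ _ (diffOp_mono hle hP) (diffOp_mono (Nat.zero_le _) hf) _⟩
    obtain ⟨r, hr⟩ : ∃ r, n + 1 = p ^ m + r := ⟨n + 1 - p ^ m, by omega⟩
    have hr' : r ≤ p ^ m - 1 := by omega
    obtain ⟨g, hg⟩ := hx.exists_leading n hP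
    have hcomp := hx.hasseD_comp (n + 1) (p ^ m) r hr.symm
    rw [hr, choose_eq_one m r (by omega), one_smul, ← hr] at hcomp
    -- the leading term is a product of an operator of order `p ^ m` and one of order `r`
    have hE : Algebra.lmul (ZMod p) R g * hx.hasseD (p ^ m) ∈ diffOp (ZMod p) R (p ^ m) :=
      lmul_mul_mem g (hx.hasseD_mem _)
    have hr2 : hx.hasseD r ∈ diffOp (ZMod p) R (p ^ m - 1) := diffOp_mono hr' (hx.hasseD_mem r)
    have big : ∀ {T : Module.End (ZMod p) R}, T ∈ diffOp (ZMod p) R (p ^ m) →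
      T ∈ diffOp (ZMod p) R (2 * p ^ m - 1) := fun h => diffOp_mono (by omega) h
    have big' : ∀ {T : Module.End (ZMod p) R}, T ∈ diffOp (ZMod p) R (p ^ m - 1) →
      T ∈ diffOp (ZMod p) R (2 * p ^ m - 1) := fun h => diffOp_mono (by omega) h
    have bigm : ∀ {T U : Module.End (ZMod p) R}, T ∈ diffOp (ZMod p) R (p ^ m) →
      U ∈ diffOp (ZMod p) R (p ^ m - 1) → T * U ∈ diffOp (ZMod p) R (2 * p ^ m - 1) :=
      fun hT hU => diffOp_mono (by omega) (mul_mem_diffOp _ _ _ rfl hT hU)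
    set E := Algebra.lmul (ZMod p) R g * hx.hasseD (p ^ m) with hEdef
    have hEr : Algebra.lmul (ZMod p) R g * hx.hasseD (n + 1) = E * hx.hasseD r := by
      rw [hEdef, mul_assoc, hcomp]
    rw [hEr] at hg
    have hlow : P - E * hx.hasseD r ∈ diffOp (ZMod p) R (2 * p ^ m - 1) :=
      diffOp_mono (by omega) hg
    have hsum : P = E * hx.hasseD r + (P - E * hx.hasseD r) := by abel
    have hop : opOf p m P h = opOf p m _ (big hE) * opOf p m _ (big' hr2)
        + opOf p m _ hlow := by
      rw [opOf_mul _ _ hE hr2 (bigm hE hr2), ← opOf_add]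
      exact opOf_congr hsum h
    obtain ⟨i1, i2⟩ := ih (by omega) hlow hg f
    have hfE := lmul_mul_mem f hE
    have hrf := mul_lmul_mem f hr2
    constructor
    · rw [hop, mul_add, i1, ← mul_assoc, fnHom_apply,
        opOf_mul' _ _ (diffOp_mono (Nat.zero_le _) hf) hE (big hfE),
        opOf_mul _ _ hfE hr2 (bigm hfE hr2), ← opOf_add]
      apply opOf_congr
      rw [mul_assoc, ← mul_add, ← hsum]
    · rw [hop, add_mul, i2, mul_assoc, fnHom_apply,
        opOf_mul _ _ (diffOp_mono (by omega) hr2) (diffOp_mono (Nat.zero_le _) hf) (big' hrf),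
        opOf_mul _ _ hE hrf (bigm hE hrf), ← opOf_add]
      apply opOf_congr
      rw [← mul_assoc, ← add_mul, ← hsum]

theorem fn_mul_opOf (hx : IsCoord p x)
    {P : Module.End (ZMod p) R} (h : P ∈ diffOp (ZMod p) R (2 * p ^ m - 1)) (f : R) :
    fnHom (ZMod p) R p m f * opOf p m P h = opOf p m _ (lmul_mul_mem f h) :=
  (hx.fn_mul_aux _ le_rfl h h f).1

theorem opOf_mul_fn (hx : IsCoord p x)
    {P : Module.End (ZMod p) R} (h : P ∈ diffOp (ZMod p) R (2 * p ^ m - 1)) (f : R) :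
    opOf p m P h * fnHom (ZMod p) R p m f = opOf p m _ (mul_lmul_mem f h) :=
  (hx.fn_mul_aux _ le_rfl h h f).2

/-- The matrix of change of coordinates. -/
def trans (y : R) (i j : Fin p) : R := hx.coef (y ^ (j : ℕ)) i

theorem sum_trans (j : Fin p) : ∑ i : Fin p, x ^ (i : ℕ) * hx.trans y i j ^ p = y ^ (j : ℕ) :=
  hx.sum_coef _

theorem entry_trans (P : Module.End (ZMod p) R) (i j : Fin p) :
    ∑ l, hx.entry P i l * Algebra.lmul (ZMod p) R (hx.trans y l j) =
      ∑ l, Algebra.lmul (ZMod p) R (hx.trans y i l) * hy.entry P l j := by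
  ext h
  have e1 : hx.coef (P (y ^ (j : ℕ) * h ^ p)) =
      fun i => ∑ l, hx.entry P i l (hx.trans y l j * h) := by
    apply hx.coef_eq
    rw [← hx.sum_trans j, Finset.sum_mul, map_sum]
    simp_rw [sum_pow_char, Finset.mul_sum]
    rw [Finset.sum_comm]
    refine Finset.sum_congr rfl fun l _ => ?_
    rw [hx.sum_entry, mul_pow, mul_assoc]
  have e2 : hx.coef (P (y ^ (j : ℕ) * h ^ p)) =
      fun i => ∑ l, hx.trans y i l * hy.entry P l j h := by
    apply hx.coef_eq
    rw [← hy.sum_entry]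
    simp_rw [sum_pow_char, Finset.mul_sum]
    rw [Finset.sum_comm]
    refine Finset.sum_congr rfl fun l _ => ?_
    rw [← hx.sum_trans l, Finset.sum_mul]
    refine Finset.sum_congr rfl fun i _ => ?_
    rw [mul_pow, mul_assoc]
  have := congrFun (e1.symm.trans e2) i
  simpa using this

variable (m) in
/-- The matrix of change of coordinates, in `𝒟^(m)`. -/
def transMat (y : R) : Matrix (Fin p) (Fin p) (DLevel (ZMod p) R p m) :=
  Matrix.of fun i j => fnHom (ZMod p) R p m (hx.trans y i j)

theorem frobAction_trans (P : DLevel (ZMod p) R p (m + 1)) :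
    hx.frobAction P * hx.transMat m y = hx.transMat m y * hy.frobAction P := by
  induction P using LevelAlg.induction with
  | scalar c => rw [AlgHom.commutes, AlgHom.commutes, Algebra.commutes]
  | add a b ha hb => rw [map_add, map_add, add_mul, mul_add, ha, hb]
  | mul a b ha hb => rw [map_mul, map_mul, mul_assoc, hb, ← mul_assoc, ha, mul_assoc]
  | of P =>
    rw [frobAction_of, frobAction_of]
    ext i j
    rw [Matrix.mul_apply, Matrix.mul_apply]
    simp only [mat_apply, transMat, Matrix.of_apply]
    simp_rw [hx.opOf_mul_fn, hx.fn_mul_opOf]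
    rw [← opOf_sum, ← opOf_sum]
    exact opOf_congr (hx.entry_trans hy P i j) _

/-- The canonical map does not depend on the coordinate. -/
theorem can_eq (P : DLevel (ZMod p) R p (m + 1)) : hx.can P = hy.can P := by
  have h0 := (Fact.out : p.Prime).pos
  change ∑ i : Fin p, toTwist p (x ^ (i : ℕ)) ⊗ₜ[R] hx.frobAction P i ⟨0, h0⟩ =
    ∑ i : Fin p, toTwist p (y ^ (i : ℕ)) ⊗ₜ[R] hy.frobAction P i ⟨0, h0⟩
  have htr : ∀ l, hx.trans y l ⟨0, h0⟩ = (Pi.single ⟨0, h0⟩ 1 : Fin p → R) l := by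
    intro l
    have := hx.coef_basis ⟨0, h0⟩ 1
    rw [pow_zero, one_pow, mul_one] at this
    rw [trans, pow_zero, this]
  have e1 : ∀ i, hx.frobAction P i ⟨0, h0⟩ = (hx.transMat m y * hy.frobAction P) i ⟨0, h0⟩ := by
    intro i
    rw [← hx.frobAction_trans hy, Matrix.mul_apply, Finset.sum_eq_single ⟨0, h0⟩]
    · rw [transMat, Matrix.of_apply, htr, Pi.single_eq_same, map_one, mul_one]
    · intro l _ hl
      rw [transMat, Matrix.of_apply, htr, Pi.single_eq_of_ne hl, map_zero, mul_zero]
    · simp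
  simp_rw [e1, Matrix.mul_apply, TensorProduct.tmul_sum]
  rw [Finset.sum_comm]
  refine Finset.sum_congr rfl fun j _ => ?_
  rw [← hx.sum_trans j]
  have : toTwist p (∑ i : Fin p, x ^ (i : ℕ) * hx.trans y i j ^ p) =
      ∑ i : Fin p, hx.trans y i j • toTwist p (x ^ (i : ℕ)) := by
    simp_rw [twist_smul, mul_comm _ (x ^ _)]
    rfl
  rw [this, TensorProduct.sum_tmul]
  refine Finset.sum_congr rfl fun i _ => ?_
  rw [TensorProduct.smul_tmul]
  rfl

end IsCoord
end Coord4

/-! ### Restriction to a principal open subset -/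

section Res

section

variable {k R B : Type*} [CommRing k] [CommRing R] [Algebra k R] [CommRing B] [Algebra k B]
variable {φ : R →ₐ[k] B} {x : R} (p m : ℕ)

/-- The restriction map of `𝒟^(m)` to a principal open subset. -/
def resLevel (hφ : IsLoc φ x) : DLevel k R p m →ₐ[k] DLevel k B p m :=
  LevelAlg.lift (LevelAlg.of ∘ₗ resOp hφ _)
    (fun c e he => LevelAlg.of_scalar c _ (resOp_eq hφ e (j := 0) (by
      rw [Algebra.algebraMap_eq_smul_one, ← map_one (Algebra.lmul k B)]
      exact Submodule.smul_mem _ _ (lmul_mem 1)) fun f => by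
        rw [he]; simp [Algebra.algebraMap_eq_smul_one]))
    (fun D D' e hD hD' he => LevelAlg.of_comm _ _ _ (resOp_mem hφ _ hD) (resOp_mem hφ _ hD')
      (resOp_eq hφ e (sub_mem (mul_mem_diffOp _ _ _ rfl (resOp_mem hφ _ hD) (resOp_mem hφ _ hD'))
        (mul_mem_diffOp _ _ _ (add_comm _ _) (resOp_mem hφ _ hD') (resOp_mem hφ _ hD)))
        fun f => by rw [he]; simp [resOp_apply]))
    (fun D D' e hD hD' he => LevelAlg.of_mul _ _ _ (resOp_mem hφ _ hD) (resOp_mem hφ _ hD')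
      (resOp_eq hφ e (mul_mem_diffOp _ _ _ rfl (resOp_mem hφ _ hD) (resOp_mem hφ _ hD'))
        fun f => by rw [he]; simp [resOp_apply]))

variable {p m}

theorem resLevel_of (hφ : IsLoc φ x) (P : diffOp k R (2 * p ^ m - 1)) :
    resLevel p m hφ (LevelAlg.of P) = LevelAlg.of (resOp hφ _ P) := LevelAlg.lift_of _ _ _ _ P

theorem resLevel_opOf (hφ : IsLoc φ x) {P : Module.End k R} (hP : P ∈ diffOp k R (2 * p ^ m - 1))
    {S : Module.End k B} (hS : S ∈ diffOp k B (2 * p ^ m - 1)) (h : ∀ f, S (φ f) = φ (P f)) :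
    resLevel p m hφ (opOf p m P hP) = opOf p m S hS := by
  rw [opOf, resLevel_of]
  exact congrArg LevelAlg.of (Subtype.ext (resOp_eq hφ _ hS h))

theorem resLevel_fn (hφ : IsLoc φ x) (f : R) :
    resLevel p m hφ (fnHom k R p m f) = fnHom k B p m (φ f) :=
  resLevel_opOf hφ _ _ fun g => by simp

end

variable {p : ℕ} [Fact p.Prime] {R B : Type*} [CommRing R] [CharP R p] [Algebra (ZMod p) R]
  [CommRing B] [CharP B p] [Algebra (ZMod p) B] {φ : R →ₐ[ZMod p] B} {x : R}

variable (p) in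
/-- The restriction map of `F^* 𝒟^(m)` to a principal open subset. -/
def resPull (m : ℕ) (hφ : IsLoc φ x) : FrobPull p m R →+ FrobPull p m B :=
  TensorProduct.liftAddHom
    { toFun := fun r =>
        { toFun := fun Q => toTwist p (φ r) ⊗ₜ[B] resLevel p m hφ Q
          map_zero' := by simp
          map_add' := fun _ _ => by simp [TensorProduct.tmul_add] }
      map_zero' := by
        ext Q
        exact (congrArg (fun z : FrobTwist p B => z ⊗ₜ[B] resLevel p m hφ Q) (map_zero φ)).trans
          (TensorProduct.zero_tmul _ _)
      map_add' := fun a b => by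
        ext Q
        exact (congrArg (fun z : FrobTwist p B => z ⊗ₜ[B] resLevel p m hφ Q) (map_add φ a b)).trans
          (TensorProduct.add_tmul _ _ _) }
    (fun f (r : R) Q => by
      change toTwist p (φ (f ^ p * (r : R))) ⊗ₜ[B] resLevel p m hφ Q =
        toTwist p (φ (r : R)) ⊗ₜ[B] resLevel p m hφ (fnHom (ZMod p) R p m f * Q)
      rw [map_mul, map_mul, map_pow, resLevel_fn, ← fn_smul_def, ← twist_smul,
        TensorProduct.smul_tmul])

theorem resPull_tmul (m : ℕ) (hφ : IsLoc φ x) (r : R) (Q : DLevel (ZMod p) R p m) :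
    resPull p m hφ (toTwist p r ⊗ₜ[R] Q) = toTwist p (φ r) ⊗ₜ[B] resLevel p m hφ Q := rfl

theorem IsCoord.coef_res (hx : IsCoord p x) (hx' : IsCoord p (φ x)) (r : R) (i : Fin p) :
    hx'.coef (φ r) i = φ (hx.coef r i) := by
  have : hx'.coef (φ r) = fun i => φ (hx.coef r i) := by
    apply hx'.coef_eq
    conv_rhs => rw [← hx.sum_coef r]
    simp
  rw [this]

theorem IsCoord.frobAction_res {m : ℕ} (hx : IsCoord p x) (hx' : IsCoord p (φ x))
    (hφ : IsLoc φ x) (P : DLevel (ZMod p) R p (m + 1)) :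
    hx'.frobAction (resLevel p (m + 1) hφ P) = (resLevel p m hφ).mapMatrix (hx.frobAction P) := by
  have : hx'.frobAction.comp (resLevel p (m + 1) hφ) =
      (resLevel p m hφ).mapMatrix.comp hx.frobAction := by
    apply LevelAlg.hom_ext
    intro P
    rw [AlgHom.comp_apply, AlgHom.comp_apply, resLevel_of, frobAction_of, frobAction_of]
    ext i j
    refine (resLevel_opOf hφ _ _ fun f => ?_).symm
    rw [entry_apply, entry_apply, ← hx.coef_res hx', ← resOp_apply hφ]
    simp
  exact DFunLike.congr_fun this P

/-- The canonical map is compatible with the restriction to a principal open subset. -/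
theorem IsCoord.can_res {m : ℕ} (hx : IsCoord p x) (hx' : IsCoord p (φ x)) (hφ : IsLoc φ x)
    (P : DLevel (ZMod p) R p (m + 1)) :
    resPull p m hφ (hx.can P) = hx'.can (resLevel p (m + 1) hφ P) := by
  rw [can_apply, can_apply, map_sum]
  simp only [resPull_tmul, hx.frobAction_res hx' hφ, map_pow, AlgHom.mapMatrix_apply,
    Matrix.map_apply]

/-- An étale coordinate remains one on the principal open subset which it defines. -/
theorem IsCoord.of_isLoc (hx : IsCoord p x) (hφ : IsLoc φ x) : IsCoord p (φ x) where
  basis := by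
    have hp0 := (Fact.out : p.Prime).ne_zero
    constructor
    · rw [injective_iff_map_eq_zero]
      intro c hc
      choose n r hr using fun i => hφ.surj (c i)
      let N := ∑ i, n i
      have hN : ∀ i, ∃ s, φ x ^ N * c i = φ s := fun i => by
        have : n i ≤ N := Finset.single_le_sum (fun _ _ => Nat.zero_le _) (Finset.mem_univ i)
        refine ⟨x ^ (N - n i) * r i, ?_⟩
        rw [map_mul, ← hr, map_pow, ← mul_assoc, ← pow_add, Nat.sub_add_cancel this]
      choose s hs using hN
      have h1 : frobSum p x s = 0 := by
        apply hφ.inj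
        have : φ (frobSum p x s) = (φ x ^ N) ^ p * frobSum p (φ x) c := by
          simp only [frobSum_apply, map_sum, map_mul, map_pow, ← hs, mul_pow, Finset.mul_sum]
          exact Finset.sum_congr rfl fun _ _ => by rw [mul_left_comm]
        rw [this, hc, mul_zero, map_zero]
      have h2 : s = 0 := hx.basis.1 (by rw [h1, map_zero])
      ext i
      have h3 := hs i
      rw [h2, Pi.zero_apply, map_zero] at h3
      exact ((hφ.unit.pow N).mul_right_eq_zero).1 h3
    · intro b
      obtain ⟨N, r, hr⟩ := hφ.surj b
      obtain ⟨w, hw⟩ := hφ.unit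
      have hr' : φ x ^ (p * N) * b = φ (x ^ ((p - 1) * N) * r) := by
        rw [map_mul, ← hr, map_pow, ← mul_assoc, ← pow_add, ← add_one_mul,
          Nat.sub_add_cancel (Nat.one_le_iff_ne_zero.2 hp0)]
      refine ⟨fun i => (↑w⁻¹ : B) ^ N * φ (hx.coef (x ^ ((p - 1) * N) * r) i), ?_⟩
      have h1 := hx.sum_coef (x ^ ((p - 1) * N) * r)
      have h2 : frobSum p (φ x) (fun i => (↑w⁻¹ : B) ^ N * φ (hx.coef (x ^ ((p - 1) * N) * r) i))
          = ((↑w⁻¹ : B) ^ N) ^ p * φ (x ^ ((p - 1) * N) * r) := by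
        conv_rhs => rw [← h1]
        simp only [frobSum_apply, map_sum, map_mul, map_pow, mul_pow, Finset.mul_sum]
        exact Finset.sum_congr rfl fun _ _ => by rw [mul_left_comm]
      rw [h2, ← hr', ← hw, ← pow_mul, mul_comm N p, ← mul_assoc, ← mul_pow, Units.inv_mul, one_pow,
        one_mul]
  gen A hA hinv := by
    have h1 := hx.gen (A.comap φ) hA fun a b hab ha =>
      hinv (φ a) (φ b) (by rw [← map_mul, hab, map_one]) ha
    have h2 : ∀ r, φ r ∈ A := fun r => (h1 ▸ Algebra.mem_top : r ∈ A.comap φ)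
    obtain ⟨w, hw⟩ := hφ.unit
    have h3 : (↑w⁻¹ : B) ∈ A := hinv w _ (Units.mul_inv w) (hw ▸ hA)
    refine eq_top_iff.2 fun b _ => ?_
    obtain ⟨N, r, hr⟩ := hφ.surj b
    have : b = (↑w⁻¹ : B) ^ N * φ r := by
      rw [← hr, ← mul_assoc, ← hw, ← mul_pow, Units.inv_mul, one_pow, one_mul]
    rw [this]
    exact mul_mem (pow_mem h3 N) (h2 r)
  hasse := by
    refine ⟨fun n => resOp hφ n ⟨hx.hasseD n, hx.hasseD_mem n⟩, ?_, fun n => ?_, fun n => ?_⟩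
    · refine resOp_eq hφ _ (j := 0) ?_ fun f => ?_
      · rw [← map_one (Algebra.lmul (ZMod p) B)]
        exact lmul_mem 1
      · simp [hx.hasseD_zero]
    · refine (resOp_eq hφ _ (j := n) (mem_diffOp_succ.1 (resOp hφ (n + 1) _).2 _) fun f => ?_).symm
      rw [ad_apply_apply, ← map_mul, resOp_apply, resOp_apply, ← map_mul, ← map_sub,
        ← ad_apply_apply, hx.ad_hasseD]
    · have := resOp_apply hφ (n + 1) ⟨hx.hasseD (n + 1), hx.hasseD_mem _⟩ 1
      rw [map_one] at this
      rw [this, hx.hasseD_one, map_zero]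

end Res

section CanSpec
variable {p m : ℕ} [Fact p.Prime] {R : Type*} [CommRing R] [CharP R p] [Algebra (ZMod p) R] {x : R}
namespace IsCoord
variable (hx : IsCoord p x)

variable (m) in
/-- The divided power `∂^<l>` of level `m`: it is `(∂^[p ^ m]) ^ q * ∂^[r]`, where `l = q p ^ m + r`
with `0 ≤ r < p ^ m`. -/
def divPow (l : ℕ) : DLevel (ZMod p) R p m :=
  have hpm : 0 < p ^ m := pow_pos (Fact.out : p.Prime).pos m
  opOf p m (hx.hasseD (p ^ m)) (diffOp_mono (by omega) (hx.hasseD_mem _)) ^ (l / p ^ m) *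
    opOf p m (hx.hasseD (l % p ^ m))
      (diffOp_mono (by have := Nat.mod_lt l hpm; omega) (hx.hasseD_mem _))

/-- The canonical map is linear over the functions. -/
theorem can_fn_smul (f : R) (P : DLevel (ZMod p) R p (m + 1)) :
    hx.can (f • P) = ∑ i : Fin p, toTwist p (f * x ^ (i : ℕ)) ⊗ₜ[R]
      hx.frobAction P i ⟨0, (Fact.out : p.Prime).pos⟩ := by
  have e : ∀ i l, hx.frobAction (fnHom (ZMod p) R p (m + 1) f) i l =
      fnHom (ZMod p) R p m (hx.coef (f * x ^ (l : ℕ)) i) := by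
    intro i l
    rw [fnHom_apply]
    refine (congrFun (congrFun (hx.frobAction_of _) i) l).trans (opOf_congr ?_ _)
    refine hx.entry_eq (fun i => Algebra.lmul (ZMod p) R (hx.coef (f * x ^ (l : ℕ)) i))
      (fun r => ?_) i
    simp only [Algebra.coe_lmul_eq_mul, LinearMap.mul_apply', mul_pow, ← mul_assoc]
    rw [← Finset.sum_mul, hx.sum_coef]
  rw [can_apply, fn_smul_def, map_mul]
  simp_rw [Matrix.mul_apply, TensorProduct.tmul_sum]
  rw [Finset.sum_comm]
  refine Finset.sum_congr rfl fun l _ => ?_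
  have : toTwist p (f * x ^ (l : ℕ)) =
      ∑ i : Fin p, hx.coef (f * x ^ (l : ℕ)) i • toTwist p (x ^ (i : ℕ)) := by
    simp_rw [twist_smul, mul_comm _ (x ^ _)]
    exact (hx.sum_coef _).symm
  rw [this, TensorProduct.sum_tmul]
  refine Finset.sum_congr rfl fun i _ => ?_
  rw [e, TensorProduct.smul_tmul, fn_smul_def]

/-- The canonical map sends `f ∂^<l>` to `f ⊗ ∂^<l / p>` if `p` divides `l`, and to `0` if not. -/
theorem can_divPow (f : R) (l : ℕ) : hx.can (f • hx.divPow (m + 1) l) =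
    if p ∣ l then toTwist p f ⊗ₜ[R] hx.divPow m (l / p) else 0 := by
  have h0 := (Fact.out : p.Prime).pos
  have hpm : 0 < p ^ m := pow_pos h0 m
  have hpm' : 0 < p ^ (m + 1) := pow_pos h0 _
  have hr1 := Nat.mod_lt l hpm'
  have hr2 := Nat.mod_lt (l / p) hpm
  have e1 : hx.frobAction (opOf p (m + 1) (hx.hasseD (p ^ (m + 1)))
      (diffOp_mono (by omega) (hx.hasseD_mem _))) = Matrix.diagonal fun _ =>
      opOf p m (hx.hasseD (p ^ m)) (diffOp_mono (by omega) (hx.hasseD_mem _)) := by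
    refine (hx.frobAction_of _).trans ?_
    ext i j
    have := hx.entry_hasseD (p ^ m) i j
    rw [← pow_succ'] at this
    refine (opOf_congr this _).trans ?_
    rcases eq_or_ne i j with rfl | hij
    · rw [Matrix.diagonal_apply_eq]
      exact opOf_congr (if_pos rfl) _
    · rw [Matrix.diagonal_apply_ne _ hij]
      refine (opOf_congr (if_neg hij) _).trans (map_zero LevelAlg.of)
  have e2 : ∀ i, hx.frobAction (opOf p (m + 1) (hx.hasseD (l % p ^ (m + 1)))
      (diffOp_mono (by omega) (hx.hasseD_mem _))) i ⟨0, h0⟩ =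
      if i = ⟨0, h0⟩ ∧ p ∣ l then opOf p m (hx.hasseD (l / p % p ^ m))
        (diffOp_mono (by omega) (hx.hasseD_mem _)) else 0 := by
    intro i
    have hd : p ∣ l % p ^ (m + 1) ↔ p ∣ l := Nat.dvd_mod_iff (dvd_pow_self p (by omega))
    have hm : l % p ^ (m + 1) / p = l / p % p ^ m := by
      rw [pow_succ', Nat.mod_mul_right_div_self]
    refine (congrFun (congrFun (hx.frobAction_of _) i) _).trans ?_
    have := hx.entry_hasseD_col_zero h0 (l % p ^ (m + 1)) i
    simp only [hm, hd] at this
    refine (opOf_congr this _).trans ?_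
    split_ifs with h
    · exact opOf_congr rfl _
    · exact map_zero LevelAlg.of
  have e3 : ∀ i, hx.frobAction (hx.divPow (m + 1) l) i ⟨0, h0⟩ =
      if i = ⟨0, h0⟩ ∧ p ∣ l then hx.divPow m (l / p) else 0 := by
    intro i
    rw [divPow, map_mul, map_pow, e1, Matrix.diagonal_pow, Matrix.diagonal_mul, e2, divPow,
      Nat.div_div_eq_div_mul, ← pow_succ', Pi.pow_apply]
    split_ifs <;> simp
  rw [can_fn_smul]
  simp_rw [e3]
  rw [Finset.sum_eq_single ⟨0, h0⟩]
  · by_cases h : p ∣ l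
    · rw [if_pos ⟨rfl, h⟩, if_pos h, pow_zero, mul_one]
    · rw [if_neg (fun h' => h h'.2), if_neg h, TensorProduct.tmul_zero]
  · intro i _ hi
    rw [if_neg (fun h' => hi h'.1), TensorProduct.tmul_zero]
  · simp

end IsCoord
end CanSpec

/-! ### The affine line -/

section Line

variable (p : ℕ) [Fact p.Prime]

/-- The coordinate of the affine line. -/
theorem isCoord_X : IsCoord p (Polynomial.X : (ZMod p)[X]) where
  basis := by
    have h0 := (Fact.out : p.Prime).pos
    constructor
    · rw [injective_iff_map_eq_zero]
      intro c hc
      ext i n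
      have h1 := congrArg (fun q : (ZMod p)[X] => q.coeff (p * n + i)) hc
      simp only [frobSum_apply, Polynomial.finsetSum_coeff, Polynomial.coeff_zero,
        ← ZMod.expand_card, Polynomial.coeff_X_pow_mul'] at h1
      rw [Finset.sum_eq_single i] at h1
      · rw [if_pos (by omega), Nat.add_sub_cancel, mul_comm, Polynomial.coeff_expand_mul h0] at h1
        simpa using h1
      · intro j _ hj
        split_ifs with hle
        · rw [Polynomial.coeff_expand h0, if_neg]
          rintro ⟨q, hq⟩
          apply hj
          ext
          have e : p * n + i = p * q + j := by omega
          have e1 := congrArg (· % p) e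
          simpa [Nat.mul_add_mod, Nat.mod_eq_of_lt i.2, Nat.mod_eq_of_lt j.2] using e1.symm
        · rfl
      · simp
    · intro f
      suffices h : f ∈ LinearMap.range (frobSum p (Polynomial.X : (ZMod p)[X])) from h
      induction f using Polynomial.induction_on' with
      | add f g hf hg => exact add_mem hf hg
      | monomial n a =>
        refine ⟨Pi.single ⟨n % p, Nat.mod_lt n h0⟩ (Polynomial.monomial (n / p) a), ?_⟩
        rw [frobSum_apply, Finset.sum_eq_single ⟨n % p, Nat.mod_lt n h0⟩]
        · rw [Pi.single_eq_same, Polynomial.monomial_pow, ZMod.pow_card, Polynomial.X_pow_mul_monomial,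
            Nat.div_add_mod' n p]
        · intro j _ hj
          rw [Pi.single_eq_of_ne hj, zero_pow h0.ne', mul_zero]
        · simp
  gen A hA _ := by
    rw [eq_top_iff, ← Polynomial.adjoin_X]
    exact Algebra.adjoin_le (Set.singleton_subset_iff.2 hA)
  hasse := by
    refine ⟨Polynomial.hasseDeriv, Polynomial.hasseDeriv_zero, fun n => ?_, fun n =>
      Polynomial.hasseDeriv_apply_one _ (Nat.succ_pos n)⟩
    refine LinearMap.ext fun f => ?_
    rw [ad_apply_apply]
    ext j
    rw [Polynomial.coeff_sub, Polynomial.hasseDeriv_coeff, Polynomial.hasseDeriv_coeff,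
      ← Nat.add_assoc, Polynomial.coeff_X_mul]
    cases j with
    | zero => simp
    | succ j =>
      rw [Polynomial.coeff_X_mul, Polynomial.hasseDeriv_coeff,
        show j + (n + 1) = j + 1 + n by ring, show j + 1 + n + 1 = (j + 1 + n) + 1 by ring,
        Nat.choose_succ_succ, Nat.cast_add]
      ring

end Line

/-! ### The group `SL₂` and its distributions -/

section SL2

variable (k : Type*) [CommRing k]

/-- The ideal of the relation `a d - b c = 1`. -/
def slIdeal : Ideal (MvPolynomial (Fin 2 × Fin 2) k) :=
  Ideal.span {MvPolynomial.X (0, 0) * MvPolynomial.X (1, 1) -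
    MvPolynomial.X (0, 1) * MvPolynomial.X (1, 0) - 1}

/-- The ring of functions of `SL₂`: `k[a, b, c, d] / (a d - b c - 1)`. -/
def SLRing : Type _ := MvPolynomial (Fin 2 × Fin 2) k ⧸ slIdeal k

instance : CommRing (SLRing k) :=
  inferInstanceAs (CommRing (MvPolynomial (Fin 2 × Fin 2) k ⧸ slIdeal k))

instance : Algebra k (SLRing k) :=
  inferInstanceAs (Algebra k (MvPolynomial (Fin 2 × Fin 2) k ⧸ slIdeal k))

/-- The projection to the ring of functions of `SL₂`. -/
def slMk : MvPolynomial (Fin 2 × Fin 2) k →ₐ[k] SLRing k := Ideal.Quotient.mkₐ k (slIdeal k)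

/-- The generic matrix of determinant `1`. -/
def genMat : Matrix (Fin 2) (Fin 2) (SLRing k) :=
  Matrix.of fun i j => slMk k (MvPolynomial.X (i, j))

theorem genMat_det : (genMat k).det = 1 := by
  rw [Matrix.det_fin_two, ← sub_eq_zero]
  simp only [genMat, Matrix.of_apply]
  rw [← map_mul, ← map_mul, ← map_sub, ← map_one (slMk k), ← map_sub]
  exact Ideal.Quotient.eq_zero_iff_mem.2 (Ideal.subset_span rfl)

variable {k}

/-- The point of `SL₂` defined by a matrix of determinant `1`. -/
def slPoint {C : Type*} [CommRing C] [Algebra k C] (M : Matrix (Fin 2) (Fin 2) C)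
    (hM : M.det = 1) : SLRing k →ₐ[k] C :=
  Ideal.Quotient.liftₐ (slIdeal k) (MvPolynomial.aeval fun ij : Fin 2 × Fin 2 => M ij.1 ij.2) (by
    have h : slIdeal k ≤ RingHom.ker
        (MvPolynomial.aeval (R := k) fun ij : Fin 2 × Fin 2 => M ij.1 ij.2) := by
      rw [slIdeal, Ideal.span_le, Set.singleton_subset_iff, SetLike.mem_coe, RingHom.mem_ker]
      rw [Matrix.det_fin_two] at hM
      simp [hM]
    exact fun a ha => h ha)

theorem slPoint_gen {C : Type*} [CommRing C] [Algebra k C] (M : Matrix (Fin 2) (Fin 2) C)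
    (hM : M.det = 1) (i j : Fin 2) : slPoint (k := k) M hM (genMat k i j) = M i j :=
  (Ideal.Quotient.liftₐ_apply (slIdeal k) _ _ _).trans
    (MvPolynomial.aeval_X (fun ij : Fin 2 × Fin 2 => M ij.1 ij.2) (i, j))

theorem sl_hom_ext {C : Type*} [CommRing C] [Algebra k C] {f g : SLRing k →ₐ[k] C}
    (h : ∀ i j, f (genMat k i j) = g (genMat k i j)) : f = g := by
  have : f.comp (slMk k) = g.comp (slMk k) := by
    apply MvPolynomial.algHom_ext
    rintro ⟨i, j⟩
    exact h i j
  ext a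
  obtain ⟨b, rfl⟩ : ∃ b, slMk k b = a := Ideal.Quotient.mk_surjective a
  exact DFunLike.congr_fun this b

variable (k)

/-- The comultiplication, `a_ij ↦ ∑ a_il ⊗ a_lj`. -/
def slComul : SLRing k →ₐ[k] SLRing k ⊗[k] SLRing k :=
  slPoint ((genMat k).map Algebra.TensorProduct.includeLeft *
    (genMat k).map (Algebra.TensorProduct.includeRight : SLRing k →ₐ[k] _)) (by
    have h1 := (AlgHom.map_det (Algebra.TensorProduct.includeLeft :
      SLRing k →ₐ[k] SLRing k ⊗[k] SLRing k) (genMat k)).symm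
    have h2 := (AlgHom.map_det (Algebra.TensorProduct.includeRight :
      SLRing k →ₐ[k] SLRing k ⊗[k] SLRing k) (genMat k)).symm
    rw [genMat_det, map_one] at h1 h2
    rw [Matrix.det_mul]
    exact (congrArg₂ (· * ·) h1 h2).trans (one_mul 1))

theorem slComul_gen (i j : Fin 2) :
    slComul k (genMat k i j) = ∑ l, genMat k i l ⊗ₜ[k] genMat k l j := by
  rw [slComul, slPoint_gen, Matrix.mul_apply]
  simp

/-- The counit: the evaluation at the identity matrix. -/
def slCounit : SLRing k →ₐ[k] k := slPoint 1 Matrix.det_one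

theorem slCounit_gen (i j : Fin 2) : slCounit k (genMat k i j) = if i = j then 1 else 0 := by
  rw [slCounit, slPoint_gen, Matrix.one_apply]

instance : Bialgebra k (SLRing k) :=
  Bialgebra.ofAlgHom (slComul k) (slCounit k)
    (by
      apply sl_hom_ext
      intro i j
      simp [slComul_gen, Fin.sum_univ_two, TensorProduct.add_tmul, TensorProduct.tmul_add]
      abel)
    (by
      apply sl_hom_ext
      intro i j
      fin_cases i <;> fin_cases j <;> simp [slComul_gen, slCounit_gen, Fin.sum_univ_two])
    (by
      apply sl_hom_ext
      intro i j
      fin_cases i <;> fin_cases j <;> simp [slComul_gen, slCounit_gen, Fin.sum_univ_two])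

/-- The maximal ideal of the identity of `SL₂`. -/
def augIdeal : Ideal (SLRing k) := RingHom.ker (slCounit k)

/-- The linear forms on the ring of functions, with the convolution product
`(μ ν)(f) = (μ ⊗ ν)(Δ f)`. -/
abbrev SLDual : Type _ := WithConv (SLRing k →ₗ[k] k)

/-- The distributions of order `≤ n` (with support in the identity): the linear forms which vanish
on the power `n + 1` of the ideal of the identity. -/
def distFil (n : ℕ) : Submodule k (SLDual k) where
  carrier := {μ | ∀ f ∈ augIdeal k ^ (n + 1), μ.ofConv f = 0}
  add_mem' := fun {a b} ha hb f hf => by simp [ha f hf, hb f hf]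
  zero_mem' := fun f _ => by simp
  smul_mem' := fun c a ha f hf => by simp [ha f hf]

variable {k}

theorem mem_distFil {n : ℕ} {μ : SLDual k} :
    μ ∈ distFil k n ↔ ∀ f ∈ augIdeal k ^ (n + 1), μ.ofConv f = 0 := Iff.rfl

theorem conv_apply (μ ν : SLDual k) (f : SLRing k) :
    (μ * ν).ofConv f = LinearMap.mul' k k (TensorProduct.map μ.ofConv ν.ofConv (slComul k f)) := rfl

/-- The enveloping algebra of level `m` of the Lie algebra of `SL₂`. -/
abbrev UEnv (p m : ℕ) : Type _ := LevelAlg p m (distFil (ZMod p))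

end SL2

/-! ### The Frobenius of the enveloping algebras -/

section Fr

variable (p : ℕ) [Fact p.Prime]

instance : CharP (SLRing (ZMod p)) p := by
  have hinj : Function.Injective (algebraMap (ZMod p) (SLRing (ZMod p))) := fun a b h => by
    simpa using congrArg (slCounit (ZMod p)) h
  exact charP_of_injective_algebraMap hinj p

/-- The transpose of the Frobenius of `SL₂`: `(Fr μ)(f) = μ (f ^ p)`. -/
def frDual : SLDual (ZMod p) →ₗ[ZMod p] SLDual (ZMod p) where
  toFun μ := WithConv.toConv (μ.ofConv ∘ₗ AddMonoidHom.toZModLinearMap p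
    (frobenius (SLRing (ZMod p)) p : SLRing (ZMod p) →+* SLRing (ZMod p)).toAddMonoidHom)
  map_add' _ _ := rfl
  map_smul' _ _ := rfl

theorem frDual_apply (μ : SLDual (ZMod p)) (f : SLRing (ZMod p)) :
    (frDual p μ).ofConv f = μ.ofConv (f ^ p) := rfl

theorem frDual_mem {a b : ℕ} (hab : a / p = b) {μ : SLDual (ZMod p)}
    (h : μ ∈ distFil (ZMod p) a) : frDual p μ ∈ distFil (ZMod p) b := by
  intro f hf
  rw [frDual_apply]
  have h1 := Ideal.pow_mem_pow hf p
  rw [← pow_mul (augIdeal (ZMod p))] at h1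
  refine h _ (Ideal.pow_le_pow_right ?_ h1)
  have := Nat.lt_mul_div_succ a (Fact.out : p.Prime).pos
  rw [hab] at this
  nlinarith

theorem frDual_mul (μ ν : SLDual (ZMod p)) : frDual p (μ * ν) = frDual p μ * frDual p ν := by
  ext f
  change LinearMap.mul' _ _ (TensorProduct.map μ.ofConv ν.ofConv (slComul (ZMod p) (f ^ p))) =
    LinearMap.mul' _ _ (TensorProduct.map (frDual p μ).ofConv (frDual p ν).ofConv
      (slComul (ZMod p) f))
  rw [map_pow]
  have : CharP (SLRing (ZMod p) ⊗[ZMod p] SLRing (ZMod p)) p := by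
    have hinj : Function.Injective (algebraMap (ZMod p)
        (SLRing (ZMod p) ⊗[ZMod p] SLRing (ZMod p))) := fun a b h => by
      simpa using congrArg (Algebra.TensorProduct.lift (slCounit (ZMod p)) (slCounit (ZMod p))
        fun _ _ => Commute.all _ _) h
    exact charP_of_injective_algebraMap hinj p
  induction slComul (ZMod p) f using TensorProduct.induction_on with
  | zero => simp [(Fact.out : p.Prime).ne_zero]
  | tmul a b => simp [Algebra.TensorProduct.tmul_pow, frDual_apply]
  | add a b ha hb => rw [add_pow_char, map_add, map_add, map_add, map_add, ha, hb]

theorem frDual_algebraMap (c : ZMod p) :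
    frDual p (algebraMap (ZMod p) _ c) = algebraMap (ZMod p) _ c := by
  ext f
  change c * slCounit (ZMod p) (f ^ p) = c * slCounit (ZMod p) f
  rw [map_pow, ZMod.pow_card]

/-- The Frobenius `U^(m+1) → U^(m)`, induced by the transpose of the Frobenius of `SL₂`. -/
def frU (m : ℕ) : UEnv p (m + 1) →ₐ[ZMod p] UEnv p m :=
  LevelAlg.lift (LevelAlg.of ∘ₗ ((frDual p).restrict fun _ hμ =>
      frDual_mem p (IsCoord.div_level m).1 hμ))
    (fun c e he => LevelAlg.of_scalar c _
      ((congrArg (frDual p) he).trans (frDual_algebraMap p c)))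
    (fun D D' e hD hD' he => LevelAlg.of_comm _ _ _
      (frDual_mem p (IsCoord.div_level m).2.1 hD) (frDual_mem p (IsCoord.div_level m).2.1 hD')
      ((congrArg (frDual p) he).trans (by
        rw [map_sub, frDual_mul, frDual_mul]; rfl)))
    (fun D D' e hD hD' he => LevelAlg.of_mul _ _ _
      (frDual_mem p (IsCoord.div_level m).2.1 hD) (frDual_mem p (IsCoord.div_level m).2.2 hD')
      ((congrArg (frDual p) he).trans (frDual_mul p _ _)))

theorem frU_of (m : ℕ) (μ : distFil (ZMod p) (2 * p ^ (m + 1) - 1)) :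
    frU p m (LevelAlg.of μ) = LevelAlg.of ⟨frDual p μ, frDual_mem p (IsCoord.div_level m).1 μ.2⟩ :=
  LevelAlg.lift_of _ _ _ _ μ

end Fr

/-! ### The action of `SL₂` on the projective line -/

section Nbhd

variable (k : Type*) [CommRing k]

/-- The ring of functions of the infinitesimal neighbourhood of order `n` of the identity. -/
def Nbhd (n : ℕ) : Type _ := SLRing k ⧸ augIdeal k ^ (n + 1)

instance (n : ℕ) : CommRing (Nbhd k n) := inferInstanceAs (CommRing (SLRing k ⧸ augIdeal k ^ (n + 1)))

instance (n : ℕ) : Algebra k (Nbhd k n) :=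
  inferInstanceAs (Algebra k (SLRing k ⧸ augIdeal k ^ (n + 1)))

/-- The restriction of functions to the infinitesimal neighbourhood of order `n`. -/
def toNbhd (n : ℕ) : SLRing k →ₐ[k] Nbhd k n := Ideal.Quotient.mkₐ k (augIdeal k ^ (n + 1))

variable {k}

theorem toNbhd_surjective (n : ℕ) : Function.Surjective (toNbhd k n) :=
  Ideal.Quotient.mk_surjective

theorem toNbhd_eq_zero {n : ℕ} {f : SLRing k} : toNbhd k n f = 0 ↔ f ∈ augIdeal k ^ (n + 1) :=
  Ideal.Quotient.eq_zero_iff_mem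

/-- A linear form of order `≤ n` on the functions, seen on the infinitesimal neighbourhood. -/
def distBar {n : ℕ} (μ : distFil k n) : Nbhd k n →ₗ[k] k :=
  have h : ∀ f g, toNbhd k n f = toNbhd k n g → μ.1.ofConv f = μ.1.ofConv g := fun f g hfg => by
    rw [← sub_eq_zero, ← map_sub, toNbhd_eq_zero] at hfg
    rw [← sub_eq_zero, ← map_sub]
    exact μ.2 _ hfg
  have hs := Function.surjInv_eq (toNbhd_surjective (k := k) n)
  { toFun := fun a => μ.1.ofConv (Function.surjInv (toNbhd_surjective (k := k) n) a)
    map_add' := fun a b => by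
      rw [← map_add]
      exact h _ _ (by rw [map_add, hs, hs, hs])
    map_smul' := fun c a => by
      rw [← map_smul]
      exact h _ _ (by rw [map_smul, hs, hs]; rfl) }

theorem distBar_apply {n : ℕ} (μ : distFil k n) (f : SLRing k) :
    distBar μ (toNbhd k n f) = μ.1.ofConv f := by
  have hs := Function.surjInv_eq (toNbhd_surjective (k := k) n) (toNbhd k n f)
  rw [← sub_eq_zero, ← map_sub, toNbhd_eq_zero] at hs
  rw [← sub_eq_zero]
  refine (map_sub μ.1.ofConv _ _).symm.trans (μ.2 _ hs)

variable {R : Type*} [CommRing R] [Algebra k R]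

/-- The contraction `R ⊗ 𝒪 → R`, `r ⊗ f ↦ μ (f) r`. -/
def contract (R : Type*) [CommRing R] [Algebra k R] {C : Type*} [CommRing C] [Algebra k C]
    (ν : C →ₗ[k] k) : R ⊗[k] C →ₗ[k] R :=
  (TensorProduct.rid k R).toLinearMap ∘ₗ LinearMap.lTensor R ν

theorem contract_tmul {C : Type*} [CommRing C] [Algebra k C] (ν : C →ₗ[k] k) (r : R) (c : C) :
    contract R ν (r ⊗ₜ c) = ν c • r := by
  simp [contract]

theorem contract_mul {C : Type*} [CommRing C] [Algebra k C] (ν : C →ₗ[k] k) (r : R)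
    (z : R ⊗[k] C) : contract R ν (r ⊗ₜ 1 * z) = r * contract R ν z := by
  induction z using TensorProduct.induction_on with
  | zero => simp
  | tmul a b => simp [contract_tmul]
  | add a b ha hb => rw [mul_add, map_add, map_add, mul_add, ha, hb]

/-- The ideal of `Spec R` in its product with the infinitesimal neighbourhood. -/
def nbhdIdeal (R : Type*) [CommRing R] [Algebra k R] (n : ℕ) : Ideal (R ⊗[k] Nbhd k n) :=
  ((augIdeal k).map (toNbhd k n)).map Algebra.TensorProduct.includeRight

theorem nbhdIdeal_pow (n : ℕ) : nbhdIdeal (k := k) R n ^ (n + 1) = ⊥ := by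
  rw [nbhdIdeal, ← Ideal.map_pow, ← Ideal.map_pow]
  have : (augIdeal k ^ (n + 1)).map (toNbhd k n) = ⊥ := by
    rw [Ideal.map_eq_bot_iff_le_ker]
    exact fun f hf => toNbhd_eq_zero.2 hf
  rw [this, Ideal.map_bot]

theorem nbhd_mem (n : ℕ) (r : R) {f : SLRing k} (hf : f ∈ augIdeal k) :
    r ⊗ₜ[k] toNbhd k n f ∈ nbhdIdeal (k := k) R n := by
  have : r ⊗ₜ[k] toNbhd k n f = r ⊗ₜ 1 * (1 ⊗ₜ toNbhd k n f) := by simp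
  rw [this]
  exact Ideal.mul_mem_left _ _ (Ideal.mem_map_of_mem _ (Ideal.mem_map_of_mem _ hf))

theorem isUnit_of_sub_mem {n : ℕ} {z w : R ⊗[k] Nbhd k n} (hw : IsUnit w)
    (h : z - w ∈ nbhdIdeal (k := k) R n) : IsUnit z := by
  have : IsNilpotent (z - w) := ⟨n + 1, by
    have := Ideal.pow_mem_pow h (n + 1)
    rwa [nbhdIdeal_pow] at this⟩
  have h2 := this.isUnit_add_left_of_commute hw (Commute.all _ _)
  simpa using h2

/-- The operator on functions `f ↦ (id ⊗ μ) (α f)`. -/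
def actOp {n : ℕ} (α : R →ₐ[k] R ⊗[k] Nbhd k n) (μ : distFil k n) : Module.End k R :=
  contract R (distBar μ) ∘ₗ α.toLinearMap

theorem actOp_mem {n : ℕ} (α : R →ₐ[k] R ⊗[k] Nbhd k n)
    (hα : ∀ f, α f - f ⊗ₜ 1 ∈ nbhdIdeal (k := k) R n) (μ : distFil k n) :
    actOp α μ ∈ diffOp k R n := by
  let T (z : R ⊗[k] Nbhd k n) : Module.End k R :=
    contract R (distBar μ) ∘ₗ LinearMap.mulLeft k z ∘ₗ α.toLinearMap
  have hT : ∀ z f, ad k R f (T z) = T (z * (α f - f ⊗ₜ 1)) := fun z f => by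
    ext h
    simp only [ad_apply_apply, T, LinearMap.comp_apply, LinearMap.mulLeft_apply,
      AlgHom.toLinearMap_apply, map_mul]
    rw [← contract_mul, ← map_sub]
    congr 1
    ring
  have key : ∀ j : ℕ, j ≤ n → ∀ z ∈ nbhdIdeal (k := k) R n ^ (n - j), T z ∈ diffOp k R j := by
    intro j
    induction j with
    | zero =>
      intro _ z hz
      rw [mem_diffOp_zero]
      intro f
      have h1 : z * (α f - f ⊗ₜ 1) ∈ nbhdIdeal (k := k) R n ^ (n + 1) := by
        rw [pow_succ]
        exact Ideal.mul_mem_mul hz (hα f)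
      rw [nbhdIdeal_pow, Ideal.mem_bot] at h1
      rw [hT, h1]
      ext h
      simp [T]
    | succ j ih =>
      intro hj z hz
      rw [mem_diffOp_succ]
      intro f
      rw [hT]
      apply ih (by omega)
      rw [show n - j = n - (j + 1) + 1 by omega, pow_succ]
      exact Ideal.mul_mem_mul hz (hα f)
  have h1 : actOp α μ = T 1 := by
    ext h
    simp [actOp, T]
  rw [h1]
  exact key n le_rfl 1 (by simp)

end Nbhd

section Hopf

variable {k : Type*} [CommRing k]

theorem sub_counit_mem (f : SLRing k) : f - algebraMap k _ (slCounit k f) ∈ augIdeal k := by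
  rw [augIdeal, RingHom.mem_ker]
  simp

theorem gen_sub_mem (i j : Fin 2) : genMat k i j - (if i = j then 1 else 0) ∈ augIdeal k := by
  have := sub_counit_mem (genMat k i j)
  rw [slCounit_gen] at this
  split_ifs at this ⊢ <;> simpa using this

/-- The multiplication of `SL₂` sends the product of the infinitesimal neighbourhoods of orders `a`
and `b` into the one of order `n ≥ a + b`. -/
theorem comul_mem {a b n : ℕ} (h : a + b ≤ n) {f : SLRing k} (hf : f ∈ augIdeal k ^ (n + 1)) :
    Algebra.TensorProduct.map (toNbhd k a) (toNbhd k b) (slComul k f) = 0 := by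
  let ψ : SLRing k →ₐ[k] Nbhd k a ⊗[k] Nbhd k b :=
    (Algebra.TensorProduct.map (toNbhd k a) (toNbhd k b)).comp (slComul k)
  let K1 : Ideal (Nbhd k a ⊗[k] Nbhd k b) :=
    ((augIdeal k).map (toNbhd k a)).map
      (Algebra.TensorProduct.includeLeft : Nbhd k a →ₐ[k] Nbhd k a ⊗[k] Nbhd k b)
  let K2 : Ideal (Nbhd k a ⊗[k] Nbhd k b) :=
    ((augIdeal k).map (toNbhd k b)).map
      (Algebra.TensorProduct.includeRight : Nbhd k b →ₐ[k] Nbhd k a ⊗[k] Nbhd k b)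
  have hb : ∀ n, (augIdeal k ^ (n + 1)).map (toNbhd k n) = ⊥ := fun n => by
    rw [Ideal.map_eq_bot_iff_le_ker]
    exact fun f hf => toNbhd_eq_zero.2 hf
  have hK1 : K1 ^ (a + 1) = 0 := by
    simp only [K1]
    rw [← Ideal.map_pow, ← Ideal.map_pow, hb, Ideal.map_bot]; rfl
  have hK2 : K2 ^ (b + 1) = 0 := by
    simp only [K2]
    rw [← Ideal.map_pow, ← Ideal.map_pow, hb, Ideal.map_bot]; rfl
  have m1 : ∀ f ∈ augIdeal k, ∀ c : Nbhd k b, toNbhd k a f ⊗ₜ[k] c ∈ K1 + K2 := fun f hf c => by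
    have : toNbhd k a f ⊗ₜ[k] c = (toNbhd k a f ⊗ₜ 1) * (1 ⊗ₜ c) := by simp
    rw [this]
    exact Ideal.mul_mem_right _ _ (Ideal.mem_sup_left
      (Ideal.mem_map_of_mem _ (Ideal.mem_map_of_mem _ hf)))
  have m2 : ∀ f ∈ augIdeal k, ∀ c : Nbhd k a, c ⊗ₜ[k] toNbhd k b f ∈ K1 + K2 := fun f hf c => by
    have : c ⊗ₜ[k] toNbhd k b f = (c ⊗ₜ 1) * (1 ⊗ₜ toNbhd k b f) := by simp
    rw [this]
    exact Ideal.mul_mem_left _ _ (Ideal.mem_sup_right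
      (Ideal.mem_map_of_mem _ (Ideal.mem_map_of_mem _ hf)))
  have h1 : (Ideal.Quotient.mkₐ k (K1 + K2)).comp ψ =
      (Algebra.ofId k _).comp (slCounit k) := by
    apply sl_hom_ext
    intro i j
    have e : Algebra.ofId k (Nbhd k a ⊗[k] Nbhd k b ⧸ (K1 + K2)) (slCounit k (genMat k i j)) =
        Ideal.Quotient.mkₐ k (K1 + K2) (algebraMap k _ (slCounit k (genMat k i j))) := by
      rw [AlgHom.commutes]; rfl
    change Ideal.Quotient.mkₐ k (K1 + K2) (ψ (genMat k i j)) =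
      Algebra.ofId k _ (slCounit k (genMat k i j))
    rw [e]
    refine (Ideal.Quotient.mk_eq_mk_iff_sub_mem _ _).2 ?_
    have e2 : ψ (genMat k i j) - algebraMap k _ (slCounit k (genMat k i j)) =
        ∑ l, (toNbhd k a (genMat k i l - (if i = l then 1 else 0)) ⊗ₜ[k] toNbhd k b (genMat k l j)) +
        1 ⊗ₜ[k] toNbhd k b (genMat k i j - (if i = j then 1 else 0)) := by
      rw [slCounit_gen]
      simp only [ψ, AlgHom.comp_apply, slComul_gen]
      fin_cases i <;> fin_cases j <;>
        simp [Fin.sum_univ_two, TensorProduct.sub_tmul, TensorProduct.tmul_sub]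
    rw [e2]
    exact add_mem (sum_mem fun l _ => m1 _ (gen_sub_mem i l) _) (m2 _ (gen_sub_mem i j) _)
  have h2 : augIdeal k ≤ (K1 + K2).comap ψ := by
    intro f hf
    have : Ideal.Quotient.mkₐ k (K1 + K2) (ψ f) = Algebra.ofId k _ (slCounit k f) :=
      DFunLike.congr_fun h1 f
    rw [show slCounit k f = 0 from hf, map_zero] at this
    exact Ideal.mem_comap.2 (Ideal.Quotient.eq_zero_iff_mem.1 this)
  have h3 : (K1 + K2) ^ (n + 1) = 0 := by
    rw [add_pow]
    refine Finset.sum_eq_zero fun i hi => ?_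
    rw [Finset.mem_range] at hi
    rcases Nat.lt_or_ge a i with h4 | h4
    · rw [pow_eq_zero_of_le h4 hK1, zero_mul, zero_mul]
    · rw [pow_eq_zero_of_le (show b + 1 ≤ n + 1 - i by omega) hK2, mul_zero, zero_mul]
  have h5 : ψ f ∈ (K1 + K2) ^ (n + 1) :=
    (Ideal.pow_right_mono h2 (n + 1)).trans (Ideal.le_comap_pow _ _) hf
  rw [h3] at h5
  exact h5

/-- The map induced by the comultiplication between infinitesimal neighbourhoods. -/
def comulBar {a b n : ℕ} (h : a + b ≤ n) : Nbhd k n →ₐ[k] Nbhd k a ⊗[k] Nbhd k b :=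
  Ideal.Quotient.liftₐ (augIdeal k ^ (n + 1))
    ((Algebra.TensorProduct.map (toNbhd k a) (toNbhd k b)).comp (slComul k))
    fun _ hf => comul_mem h hf

theorem comulBar_apply {a b n : ℕ} (h : a + b ≤ n) (f : SLRing k) :
    comulBar h (toNbhd k n f) =
      Algebra.TensorProduct.map (toNbhd k a) (toNbhd k b) (slComul k f) := rfl

/-- The tensor product of two linear forms. -/
def tensorForm {C D : Type*} [CommRing C] [Algebra k C] [CommRing D] [Algebra k D]
    (μ : C →ₗ[k] k) (ν : D →ₗ[k] k) : C ⊗[k] D →ₗ[k] k :=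
  LinearMap.mul' k k ∘ₗ TensorProduct.map μ ν

theorem conv_mem {a b n : ℕ} (h : a + b ≤ n) {μ ν : SLDual k} (hμ : μ ∈ distFil k a)
    (hν : ν ∈ distFil k b) : μ * ν ∈ distFil k n ∧ ∀ f : SLRing k, (μ * ν).ofConv f =
      tensorForm (distBar ⟨μ, hμ⟩) (distBar ⟨ν, hν⟩) (comulBar h (toNbhd k n f)) := by
  have e : ∀ f : SLRing k, (μ * ν).ofConv f =
      tensorForm (distBar ⟨μ, hμ⟩) (distBar ⟨ν, hν⟩) (comulBar h (toNbhd k n f)) := by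
    intro f
    rw [conv_apply, comulBar_apply]
    induction slComul k f using TensorProduct.induction_on with
    | zero => simp
    | tmul x y => simp [tensorForm, distBar_apply]
    | add x y hx hy => rw [map_add, map_add, map_add, map_add, hx, hy]
  refine ⟨fun f hf => ?_, e⟩
  rw [e, toNbhd_eq_zero.2 hf, map_zero, map_zero]

end Hopf

section Action

variable {k : Type*} [CommRing k] {R : Type*} [CommRing R] [Algebra k R]

/-- Compatible (right) actions on `Spec R` of the infinitesimal neighbourhoods of the identity. -/
structure IsNbhdAct (α : ∀ n, R →ₐ[k] R ⊗[k] Nbhd k n) : Prop where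
  near : ∀ n f, α n f - f ⊗ₜ 1 ∈ nbhdIdeal (k := k) R n
  comul : ∀ (a b n : ℕ) (h : a + b ≤ n) (f : R),
    Algebra.TensorProduct.assoc k k k R (Nbhd k a) (Nbhd k b)
      (Algebra.TensorProduct.map (α a) (AlgHom.id k (Nbhd k b)) (α b f)) =
    Algebra.TensorProduct.map (AlgHom.id k R) (comulBar h) (α n f)

theorem contract_tensorForm {a b : ℕ} (α : R →ₐ[k] R ⊗[k] Nbhd k a) (μ : distFil k a)
    (ν : distFil k b) (z : R ⊗[k] Nbhd k b) :
    contract R (tensorForm (distBar μ) (distBar ν))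
      (Algebra.TensorProduct.assoc k k k R (Nbhd k a) (Nbhd k b)
        (Algebra.TensorProduct.map α (AlgHom.id k (Nbhd k b)) z)) =
    actOp α μ (contract R (distBar ν) z) := by
  induction z using TensorProduct.induction_on with
  | zero => simp
  | add x y hx hy => rw [map_add, map_add, map_add, map_add, map_add, hx, hy]
  | tmul r c =>
    rw [contract_tmul, map_smul]
    change _ = distBar ν c • contract R (distBar μ) (α r)
    rw [Algebra.TensorProduct.map_tmul]
    induction α r using TensorProduct.induction_on with
    | zero => simp
    | add x y hx hy => rw [TensorProduct.add_tmul, map_add, map_add, map_add, smul_add, hx, hy]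
    | tmul s d =>
      rw [AlgHom.id_apply, Algebra.TensorProduct.assoc_tmul, contract_tmul, contract_tmul,
        smul_smul]
      congr 1
      simp [tensorForm, mul_comm]

theorem contract_comp {C D : Type*} [CommRing C] [Algebra k C] [CommRing D] [Algebra k D]
    (μ : C →ₗ[k] k) (ν : D →ₗ[k] k) (g : C →ₐ[k] D) (h : ∀ c, μ c = ν (g c)) (z : R ⊗[k] C) :
    contract R ν (Algebra.TensorProduct.map (AlgHom.id k R) g z) = contract R μ z := by
  induction z using TensorProduct.induction_on with
  | zero => simp
  | add x y hx hy => rw [map_add, map_add, map_add, hx, hy]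
  | tmul s d => rw [Algebra.TensorProduct.map_tmul, contract_tmul, contract_tmul, h]; rfl

variable {α : ∀ n, R →ₐ[k] R ⊗[k] Nbhd k n}

namespace IsNbhdAct

theorem actOp_mul (hα : IsNbhdAct α) {a b n : ℕ} (h : a + b ≤ n) {μ ν : SLDual k}
    (hμ : μ ∈ distFil k a) (hν : ν ∈ distFil k b) :
    actOp (α n) ⟨μ * ν, (conv_mem h hμ hν).1⟩ = actOp (α a) ⟨μ, hμ⟩ * actOp (α b) ⟨ν, hν⟩ := by
  ext f
  rw [Module.End.mul_apply]
  change contract R _ (α n f) = actOp (α a) ⟨μ, hμ⟩ (contract R (distBar ⟨ν, hν⟩) (α b f))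
  rw [← contract_tensorForm, hα.comul a b n h]
  refine (contract_comp _ _ (comulBar h) (fun c => ?_) _).symm
  obtain ⟨c, rfl⟩ := toNbhd_surjective n c
  rw [distBar_apply]
  exact (conv_mem h hμ hν).2 c

theorem scalar_mem (c : k) (n : ℕ) : algebraMap k (SLDual k) c ∈ distFil k n := by
  intro f hf
  have h1 : f ∈ augIdeal k := Ideal.pow_le_self (Nat.succ_ne_zero n) hf
  change c * slCounit k f = 0
  rw [show slCounit k f = 0 from h1, mul_zero]

theorem actOp_scalar (hα : IsNbhdAct α) (c : k) (n : ℕ) :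
    actOp (α n) ⟨algebraMap k (SLDual k) c, scalar_mem c n⟩ = algebraMap k _ c := by
  ext f
  let ε : Nbhd k n →ₐ[k] k := Ideal.Quotient.liftₐ (augIdeal k ^ (n + 1)) (slCounit k)
    fun f hf => Ideal.pow_le_self (Nat.succ_ne_zero n) hf
  have hε : ∀ g, ε (toNbhd k n g) = slCounit k g := fun g => rfl
  let g : R ⊗[k] Nbhd k n →ₐ[k] R :=
    (Algebra.TensorProduct.rid k k R).toAlgHom.comp
      (Algebra.TensorProduct.map (AlgHom.id k R) ε)
  have hle : nbhdIdeal (k := k) R n ≤ RingHom.ker g := by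
    rw [nbhdIdeal, Ideal.map_le_iff_le_comap, Ideal.map_le_iff_le_comap]
    intro y hy
    change g (1 ⊗ₜ toNbhd k n y) = 0
    change (ε (toNbhd k n y)) • (1 : R) = 0
    rw [hε, show slCounit k y = 0 from hy, zero_smul]
  have hg : ∀ z, contract R (distBar (⟨algebraMap k (SLDual k) c, scalar_mem c n⟩ :
      distFil k n)) z = c • g z := by
    intro z
    induction z using TensorProduct.induction_on with
    | zero => simp
    | add x y hx hy => rw [map_add, map_add, smul_add, hx, hy]
    | tmul r d =>
      obtain ⟨d, rfl⟩ := toNbhd_surjective n d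
      rw [contract_tmul, distBar_apply]
      change (c * slCounit k d) • r = c • (slCounit k d • r)
      rw [mul_smul]
  refine (hg _).trans ?_
  have h1 : g (α n f) = f := by
    have h2 : g (α n f - f ⊗ₜ 1) = 0 := hle (hα.near n f)
    rw [map_sub, sub_eq_zero] at h2
    refine h2.trans ?_
    change ε 1 • f = f
    rw [map_one, one_smul]
  change c • g (α n f) = _
  rw [h1]
  rfl

theorem actOp_congr {n : ℕ} {μ ν : SLDual k} (h : μ = ν) (hμ : μ ∈ distFil k n) :
    actOp (α n) ⟨μ, hμ⟩ = actOp (α n) ⟨ν, h ▸ hμ⟩ := by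
  subst h; rfl

theorem actOp_level (hα : IsNbhdAct α) {a n : ℕ} (h : a ≤ n) {μ : SLDual k}
    (hμ : μ ∈ distFil k a) (hμ' : μ ∈ distFil k n) :
    actOp (α n) ⟨μ, hμ'⟩ = actOp (α a) ⟨μ, hμ⟩ := by
  have h1 := hα.actOp_mul (show a + 0 ≤ n by omega) hμ (scalar_mem (1 : k) 0)
  rw [actOp_scalar hα, map_one (algebraMap k (Module.End k R)), mul_one] at h1
  rw [← h1]
  exact actOp_congr (by rw [map_one, mul_one]) hμ'

theorem actOp_eq (hα : IsNbhdAct α) {a n : ℕ} {μ : SLDual k}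
    (hμ : μ ∈ distFil k a) (hμ' : μ ∈ distFil k n) :
    actOp (α n) ⟨μ, hμ'⟩ = actOp (α a) ⟨μ, hμ⟩ := by
  have h : μ ∈ distFil k (a + n) := by
    have := (conv_mem (n := a + n) le_rfl hμ (scalar_mem (1 : k) n)).1
    rwa [map_one, mul_one] at this
  rw [← hα.actOp_level (Nat.le_add_right a n) hμ h, ← hα.actOp_level (Nat.le_add_left n a) hμ' h]

theorem actOp_mem (hα : IsNbhdAct α) {a n : ℕ} {μ : SLDual k}
    (hμ : μ ∈ distFil k a) (hμ' : μ ∈ distFil k n) : actOp (α n) ⟨μ, hμ'⟩ ∈ diffOp k R a := by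
  rw [hα.actOp_eq hμ hμ']
  exact ArithD.actOp_mem _ (hα.near a) _

theorem contract_add {n : ℕ} (μ ν : distFil k n) (z : R ⊗[k] Nbhd k n) :
    contract R (distBar (μ + ν)) z = contract R (distBar μ) z + contract R (distBar ν) z := by
  induction z using TensorProduct.induction_on with
  | zero => simp
  | add x y hx hy => rw [map_add, map_add, map_add, hx, hy]; abel
  | tmul r d =>
    obtain ⟨d, rfl⟩ := toNbhd_surjective n d
    rw [contract_tmul, contract_tmul, contract_tmul, ← add_smul]
    simp only [distBar_apply]
    rfl

theorem contract_smul {n : ℕ} (c : k) (μ : distFil k n) (z : R ⊗[k] Nbhd k n) :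
    contract R (distBar (c • μ)) z = c • contract R (distBar μ) z := by
  induction z using TensorProduct.induction_on with
  | zero => simp
  | add x y hx hy => rw [map_add, map_add, smul_add, hx, hy]
  | tmul r d =>
    obtain ⟨d, rfl⟩ := toNbhd_surjective n d
    rw [contract_tmul, contract_tmul, smul_smul]
    simp only [distBar_apply]
    rfl

/-- The operators on functions defined by the distributions of order `≤ n`, as a linear map. -/
def opLin (hα : IsNbhdAct α) (n : ℕ) : distFil k n →ₗ[k] diffOp k R n where
  toFun μ := ⟨actOp (α n) μ, hα.actOp_mem μ.2 μ.2⟩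
  map_add' μ ν := Subtype.ext (LinearMap.ext fun _ => contract_add μ ν _)
  map_smul' c μ := Subtype.ext (LinearMap.ext fun _ => contract_smul c μ _)

theorem actOp_add (hα : IsNbhdAct α) {n : ℕ} (μ ν : distFil k n) :
    actOp (α n) (μ + ν) = actOp (α n) μ + actOp (α n) ν :=
  congrArg Subtype.val (map_add (hα.opLin n) μ ν)

theorem opLin_mem (hα : IsNbhdAct α) {a n : ℕ} (μ : distFil k n) (hμ : (μ : SLDual k) ∈ distFil k a) :
    (hα.opLin n μ : Module.End k R) ∈ diffOp k R a :=
  hα.actOp_mem (μ := μ.1) hμ μ.2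

theorem opLin_mul (hα : IsNbhdAct α) {a b n : ℕ} (h : a + b ≤ n) (μ ν e : distFil k n)
    (hμ : (μ : SLDual k) ∈ distFil k a) (hν : (ν : SLDual k) ∈ distFil k b)
    (he : (e : SLDual k) = μ * ν) : (hα.opLin n e : Module.End k R) =
      hα.opLin n μ * hα.opLin n ν := by
  change actOp (α n) ⟨e.1, e.2⟩ = actOp (α n) ⟨μ.1, μ.2⟩ * actOp (α n) ⟨ν.1, ν.2⟩
  rw [hα.actOp_eq hμ μ.2, hα.actOp_eq hν ν.2, ← hα.actOp_mul h]
  exact actOp_congr he e.2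

theorem opLin_comm (hα : IsNbhdAct α) {a n : ℕ} (μ ν e : distFil k n)
    (hμ : (μ : SLDual k) ∈ distFil k a) (hν : (ν : SLDual k) ∈ distFil k a)
    (he : (e : SLDual k) = μ * ν - ν * μ) : (hα.opLin n e : Module.End k R) =
      hα.opLin n μ * hα.opLin n ν - hα.opLin n ν * hα.opLin n μ := by
  have h1 := (conv_mem (n := a + a) (by omega) hμ hν).1
  have h2 := (conv_mem (n := a + a) (by omega) hν hμ).1
  have h3 : e.1 ∈ distFil k (a + a) := by rw [he]; exact sub_mem h1 h2
  change actOp (α n) ⟨e.1, e.2⟩ = actOp (α n) ⟨μ.1, μ.2⟩ * actOp (α n) ⟨ν.1, ν.2⟩ -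
    actOp (α n) ⟨ν.1, ν.2⟩ * actOp (α n) ⟨μ.1, μ.2⟩
  rw [hα.actOp_eq h3 e.2, hα.actOp_eq hμ μ.2, hα.actOp_eq hν ν.2, ← hα.actOp_mul le_rfl,
    ← hα.actOp_mul le_rfl]
  have h4 : (⟨e.1, h3⟩ : distFil k (a + a)) + ⟨_, h2⟩ = ⟨_, h1⟩ := by
    apply Subtype.ext
    change e.1 + ν.1 * μ.1 = μ.1 * ν.1
    rw [he, sub_add_cancel]
  rw [← h4, hα.actOp_add, add_sub_cancel_right]

theorem opLin_scalar (hα : IsNbhdAct α) {n : ℕ} (c : k) (e : distFil k n)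
    (he : (e : SLDual k) = algebraMap k _ c) :
    (hα.opLin n e : Module.End k R) = algebraMap k _ c :=
  (actOp_congr (α := α) he e.2).trans (hα.actOp_scalar c n)

/-- The morphism `U^(m) → 𝒟^(m)` induced by an action. -/
def toLevel (hα : IsNbhdAct α) (p : ℕ) [Fact p.Prime] (m : ℕ) :
    LevelAlg p m (distFil k) →ₐ[k] DLevel k R p m :=
  LevelAlg.lift (LevelAlg.of ∘ₗ hα.opLin (2 * p ^ m - 1))
    (fun c e he => LevelAlg.of_scalar c _ (hα.opLin_scalar c e he))
    (fun D D' e hD hD' he => LevelAlg.of_comm _ _ _ (hα.opLin_mem D hD) (hα.opLin_mem D' hD')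
      (hα.opLin_comm D D' e hD hD' he))
    (fun D D' e hD hD' he => LevelAlg.of_mul _ _ _ (hα.opLin_mem D hD) (hα.opLin_mem D' hD')
      (hα.opLin_mul (by have := pow_pos (Fact.out : p.Prime).pos m; omega) D D' e hD hD' he))

theorem toLevel_of (hα : IsNbhdAct α) (p : ℕ) [Fact p.Prime] (m : ℕ)
    (μ : distFil k (2 * p ^ m - 1)) : hα.toLevel p m (LevelAlg.of μ) =
      LevelAlg.of (hα.opLin (2 * p ^ m - 1) μ) :=
  LevelAlg.lift_of _ _ _ _ μ

end IsNbhdAct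
end Action

section Moebius

variable {k : Type} [CommRing k] {R : Type} [CommRing R] [Algebra k R]

/-- The linear form `x a_ij + a_(1-i)j`, in the functions on the product of `Spec R` and an
infinitesimal neighbourhood of the identity of `SL₂`. -/
def linForm (x : R) (n : ℕ) (i j : Fin 2) : R ⊗[k] Nbhd k n :=
  x ⊗ₜ toNbhd k n (genMat k i j) + 1 ⊗ₜ toNbhd k n (genMat k (1 - i) j)

theorem toNbhd_gen_mem (n : ℕ) (r : R) {i j : Fin 2} (h : i ≠ j) :
    r ⊗ₜ[k] toNbhd k n (genMat k i j) ∈ nbhdIdeal (k := k) R n := by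
  have := gen_sub_mem (k := k) i j
  rw [if_neg h, sub_zero] at this
  exact nbhd_mem n r this

theorem toNbhd_gen_sub_mem (n : ℕ) (r : R) (i : Fin 2) :
    r ⊗ₜ[k] toNbhd k n (genMat k i i) - r ⊗ₜ 1 ∈ nbhdIdeal (k := k) R n := by
  have := gen_sub_mem (k := k) i i
  rw [if_pos rfl] at this
  rw [← TensorProduct.tmul_sub, ← map_one (toNbhd k n), ← map_sub]
  exact nbhd_mem n r this

theorem linForm_self (x : R) (n : ℕ) (j : Fin 2) :
    linForm (k := k) x n j j - x ⊗ₜ 1 ∈ nbhdIdeal (k := k) R n := by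
  rw [linForm, add_sub_right_comm]
  refine add_mem (toNbhd_gen_sub_mem n x j) (toNbhd_gen_mem n 1 ?_)
  fin_cases j <;> simp

theorem linForm_other (x : R) (n : ℕ) (j : Fin 2) :
    linForm (k := k) x n j (1 - j) - 1 ∈ nbhdIdeal (k := k) R n := by
  rw [linForm, add_sub_assoc]
  refine add_mem (toNbhd_gen_mem n x ?_) (toNbhd_gen_sub_mem n 1 (1 - j))
  fin_cases j <;> simp

theorem linForm_unit (x : R) (n : ℕ) (j : Fin 2) : IsUnit (linForm (k := k) x n j (1 - j)) :=
  isUnit_of_sub_mem isUnit_one (linForm_other x n j)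

/-- `α x = (x a_jj + a_ij) / (x a_ji + a_ii)`, where `i = 1 - j`. -/
def IsMoebius (x : R) (j : Fin 2) (α : ∀ n, R →ₐ[k] R ⊗[k] Nbhd k n) : Prop :=
  ∀ n, α n x * linForm x n j (1 - j) = linForm x n j j

namespace IsMoebius
variable {x : R} {j : Fin 2} {α : ∀ n, R →ₐ[k] R ⊗[k] Nbhd k n}

theorem near_coord (h : IsMoebius x j α) (n : ℕ) : α n x - x ⊗ₜ 1 ∈ nbhdIdeal (k := k) R n := by
  rw [← Ideal.unit_mul_mem_iff_mem _ (linForm_unit (k := k) x n j), mul_sub, mul_comm, h n]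
  have h2 := Ideal.mul_mem_left _ (x ⊗ₜ[k] (1 : Nbhd k n)) (linForm_other (k := k) x n j)
  have := sub_mem (linForm_self (k := k) x n j) h2
  convert this using 1
  ring

theorem near (h : IsMoebius x j α)
    (hR : ∀ {C : Type} [CommRing C] [Algebra k C] {f g : R →ₐ[k] C}, f x = g x → f = g) (n : ℕ)
    (f : R) : α n f - f ⊗ₜ 1 ∈ nbhdIdeal (k := k) R n := by
  have : (Ideal.Quotient.mkₐ k (nbhdIdeal (k := k) R n)).comp (α n) =
      (Ideal.Quotient.mkₐ k (nbhdIdeal (k := k) R n)).comp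
        (Algebra.TensorProduct.includeLeft) :=
    hR ((Ideal.Quotient.mk_eq_mk_iff_sub_mem _ _).2 (h.near_coord n))
  exact (Ideal.Quotient.mk_eq_mk_iff_sub_mem _ _).1 (DFunLike.congr_fun this f)

theorem comul_coord (h : IsMoebius x j α) (a b n : ℕ) (hab : a + b ≤ n) :
    Algebra.TensorProduct.assoc k k k R (Nbhd k a) (Nbhd k b)
      (Algebra.TensorProduct.map (α a) (AlgHom.id k (Nbhd k b)) (α b x)) =
    Algebra.TensorProduct.map (AlgHom.id k R) (comulBar hab) (α n x) := by
  let Φ : R ⊗[k] Nbhd k b →ₐ[k] R ⊗[k] (Nbhd k a ⊗[k] Nbhd k b) :=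
    (Algebra.TensorProduct.assoc k k k R (Nbhd k a) (Nbhd k b)).toAlgHom.comp
      (Algebra.TensorProduct.map (α a) (AlgHom.id k (Nbhd k b)))
  let Ψ : R ⊗[k] Nbhd k n →ₐ[k] R ⊗[k] (Nbhd k a ⊗[k] Nbhd k b) :=
    Algebra.TensorProduct.map (AlgHom.id k R) (comulBar hab)
  let Ω : R ⊗[k] Nbhd k a →ₐ[k] R ⊗[k] (Nbhd k a ⊗[k] Nbhd k b) :=
    (Algebra.TensorProduct.assoc k k k R (Nbhd k a) (Nbhd k b)).toAlgHom.comp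
      Algebra.TensorProduct.includeLeft
  let g : Fin 2 → Fin 2 → R ⊗[k] (Nbhd k a ⊗[k] Nbhd k b) := fun i j =>
    1 ⊗ₜ (toNbhd k a (genMat k i j) ⊗ₜ 1)
  let e : Fin 2 → Fin 2 → R ⊗[k] (Nbhd k a ⊗[k] Nbhd k b) := fun i j =>
    1 ⊗ₜ (1 ⊗ₜ toNbhd k b (genMat k i j))
  let X : R ⊗[k] (Nbhd k a ⊗[k] Nbhd k b) := x ⊗ₜ 1
  have h1 := congrArg Ω (h a)
  have h2 := congrArg Φ (h b)
  have h3 := congrArg Ψ (h n)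
  have e1 : ∀ l, Ω (linForm x a j l) = X * g j l + g (1 - j) l := fun l => by
    simp [Ω, linForm, g, X, TensorProduct.add_tmul]
  have e2 : ∀ l, Φ (linForm x b j l) = Ω (α a x) * e j l + e (1 - j) l := fun l => by
    have : ∀ (z : R ⊗[k] Nbhd k a) (y : Nbhd k b),
        Algebra.TensorProduct.assoc k k k R (Nbhd k a) (Nbhd k b) (z ⊗ₜ y) =
          Ω z * (1 ⊗ₜ (1 ⊗ₜ y)) := fun z y => by
      have h4 : z ⊗ₜ[k] y = z ⊗ₜ 1 * 1 ⊗ₜ y := by simp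
      rw [h4, map_mul, Algebra.TensorProduct.one_def, Algebra.TensorProduct.assoc_tmul]
      rfl
    change Algebra.TensorProduct.assoc k k k R (Nbhd k a) (Nbhd k b)
      (Algebra.TensorProduct.map (α a) (AlgHom.id k (Nbhd k b)) _) = _
    rw [linForm, map_add, map_add, Algebra.TensorProduct.map_tmul,
      Algebra.TensorProduct.map_tmul, this, this, map_one, map_one, one_mul]
    rfl
  have e3 : ∀ l, Ψ (linForm x n j l) = X * (g j j * e j l + g j (1 - j) * e (1 - j) l) +
      (g (1 - j) j * e j l + g (1 - j) (1 - j) * e (1 - j) l) := fun l => by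
    simp only [Ψ, linForm, map_add, Algebra.TensorProduct.map_tmul, comulBar_apply, slComul_gen,
      map_sum, AlgHom.id_apply]
    fin_cases j <;> simp [Fin.sum_univ_two, g, e, X, TensorProduct.tmul_add, mul_add] <;>
      abel
  have hu : IsUnit (Ψ (linForm x n j (1 - j))) := (linForm_unit x n j).map Ψ
  change Φ (α b x) = Ψ (α n x)
  rw [map_mul] at h1 h2 h3
  apply hu.mul_right_cancel
  rw [h3]
  rw [e1, e1] at h1
  rw [e2, e2] at h2
  rw [e3, e3]
  linear_combination (X * g j (1 - j) + g (1 - j) (1 - j)) * h2 +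
    (e j j - Φ (α b x) * e j (1 - j)) * h1

theorem isNbhdAct (h : IsMoebius x j α)
    (hR : ∀ {C : Type} [CommRing C] [Algebra k C] {f g : R →ₐ[k] C}, f x = g x → f = g) :
    IsNbhdAct α where
  near n f := h.near hR n f
  comul a b n hab f := DFunLike.congr_fun (hR (f :=
    ((Algebra.TensorProduct.assoc k k k R (Nbhd k a) (Nbhd k b)).toAlgHom.comp
      (Algebra.TensorProduct.map (α a) (AlgHom.id k (Nbhd k b)))).comp (α b))
    (g := (Algebra.TensorProduct.map (AlgHom.id k R) (comulBar hab)).comp (α n))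
    (h.comul_coord a b n hab)) f

end IsMoebius

end Moebius

section Charts

variable (k : Type) [CommRing k]

/-- The action of the infinitesimal neighbourhoods of the identity of `SL₂` on the affine chart
`z_i ≠ 0` of the projective line, with coordinate `X = z_j / z_i`, `j = 1 - i`: it is induced by
the action `z ↦ z g` on row vectors. -/
def chartAct (i : Fin 2) (n : ℕ) : k[X] →ₐ[k] k[X] ⊗[k] Nbhd k n :=
  Polynomial.aeval (linForm (Polynomial.X : k[X]) n (1 - i) (1 - i) *
    Ring.inverse (linForm (Polynomial.X : k[X]) n (1 - i) i))

theorem one_sub_one_sub (i : Fin 2) : 1 - (1 - i) = i := by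
  fin_cases i <;> rfl

theorem chartAct_isMoebius (i : Fin 2) : IsMoebius Polynomial.X (1 - i) (chartAct k i) := by
  intro n
  have h := linForm_unit (k := k) (Polynomial.X : k[X]) n (1 - i)
  rw [one_sub_one_sub] at *
  rw [chartAct, Polynomial.aeval_X, mul_assoc, Ring.inverse_mul_cancel _ h, mul_one]

theorem chartAct_isNbhdAct (i : Fin 2) : IsNbhdAct (chartAct k i) :=
  (chartAct_isMoebius k i).isNbhdAct fun h => Polynomial.algHom_ext h

/-- The ring of the intersection `Spec k[T, T⁻¹]` of the two charts as an extension of the ring of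
the chart `i`: `z₁ / z₀ = T`, `z₀ / z₁ = T⁻¹`. -/
def chartEmb (i : Fin 2) : k[X] →ₐ[k] k[T;T⁻¹] :=
  Polynomial.aeval (LaurentPolynomial.T (if i = 0 then 1 else -1))

theorem chartEmb_X (i : Fin 2) :
    chartEmb k i Polynomial.X = LaurentPolynomial.T (if i = 0 then 1 else -1) :=
  Polynomial.aeval_X _

theorem chartEmb_zero : chartEmb k 0 = Polynomial.toLaurentAlg :=
  Polynomial.algHom_ext (by rw [chartEmb_X]; simp)

theorem chartEmb_one : chartEmb k 1 =
    (LaurentPolynomial.invert (R := k)).toAlgHom.comp Polynomial.toLaurentAlg :=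
  Polynomial.algHom_ext (by rw [chartEmb_X]; simp)

theorem chartEmb_isLoc (i : Fin 2) : IsLoc (chartEmb k i) Polynomial.X := by
  have h0 : IsLoc (chartEmb k 0) Polynomial.X := by
    rw [chartEmb_zero]
    refine ⟨Polynomial.toLaurent_injective, ?_, fun b => ?_⟩
    · rw [Polynomial.toLaurentAlg_apply, Polynomial.toLaurent_X]
      exact LaurentPolynomial.isUnit_T 1
    · obtain ⟨n, f, hf⟩ := LaurentPolynomial.exists_T_pow b
      refine ⟨n, f, ?_⟩
      rw [Polynomial.toLaurentAlg_apply, Polynomial.toLaurentAlg_apply, hf, Polynomial.toLaurent_X,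
        LaurentPolynomial.T_pow, mul_comm]
      simp
  fin_cases i
  · exact h0
  · change IsLoc (chartEmb k 1) Polynomial.X
    have h1 : ∀ f, chartEmb k 1 f = LaurentPolynomial.invert (R := k) (chartEmb k 0 f) := fun f => by
      rw [chartEmb_one, chartEmb_zero]; rfl
    refine ⟨fun a b h => ?_, ?_, fun b => ?_⟩
    · rw [h1, h1] at h
      exact h0.inj ((LaurentPolynomial.invert (R := k)).injective h)
    · rw [h1]
      exact h0.unit.map _
    · obtain ⟨n, r, hr⟩ := h0.surj (LaurentPolynomial.invert (R := k) b)
      refine ⟨n, r, ?_⟩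
      rw [h1, h1, ← hr, map_mul, map_pow, LaurentPolynomial.involutive_invert b]

variable {k}

theorem IsLoc.algHom_ext {R B : Type*} [CommRing R] [Algebra k R] [CommRing B] [Algebra k B]
    {φ : R →ₐ[k] B} {x : R} (hφ : IsLoc φ x) {C : Type*} [CommRing C] [Algebra k C]
    {f g : B →ₐ[k] C} (h : f.comp φ = g.comp φ) : f = g := by
  ext b
  obtain ⟨n, r, hr⟩ := hφ.surj b
  have h1 := congrArg f hr
  have h2 := congrArg g hr
  have h3 : ∀ r, f (φ r) = g (φ r) := DFunLike.congr_fun h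
  rw [map_mul, map_pow] at h1 h2
  rw [h3, h3, ← h2] at h1
  exact ((hφ.unit.map g).pow n).mul_left_cancel h1

variable (k)

theorem exists_overlap : ∃ β : ∀ n, k[T;T⁻¹] →ₐ[k] k[T;T⁻¹] ⊗[k] Nbhd k n,
    IsNbhdAct β ∧ ∀ i n, (β n).comp (chartEmb k i) =
      (Algebra.TensorProduct.map (chartEmb k i) (AlgHom.id k (Nbhd k n))).comp (chartAct k i n) := by
  let t : k[T;T⁻¹] := LaurentPolynomial.T 1
  let s : k[T;T⁻¹] := LaurentPolynomial.T (-1)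
  have hts : t * s = 1 := by rw [← LaurentPolynomial.T_add]; simp
  have h0 : ∀ n, IsUnit (linForm (k := k) t n 1 0) := fun n => linForm_unit t n 1
  have h1 : ∀ n, IsUnit (linForm (k := k) t n 1 1) := fun n =>
    isUnit_of_sub_mem ((IsUnit.of_mul_eq_one s hts).map
      (Algebra.TensorProduct.includeLeft : k[T;T⁻¹] →ₐ[k] k[T;T⁻¹] ⊗[k] Nbhd k n))
      (linForm_self (k := k) t n 1)
  let w : ∀ n, (k[T;T⁻¹] ⊗[k] Nbhd k n)ˣ := fun n => (h1 n).unit * (h0 n).unit⁻¹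
  have hw : ∀ n, (w n : k[T;T⁻¹] ⊗[k] Nbhd k n) * linForm t n 1 0 = linForm t n 1 1 := fun n => by
    simp only [w, Units.val_mul, IsUnit.unit_spec]
    rw [mul_assoc, IsUnit.val_inv_mul, mul_one]
  let β : ∀ n, k[T;T⁻¹] →ₐ[k] k[T;T⁻¹] ⊗[k] Nbhd k n := fun n =>
    { LaurentPolynomial.eval₂ (algebraMap k _) (w n) with
      commutes' := fun r => LaurentPolynomial.eval₂_C _ _ r }
  have hβ : ∀ n, β n t = w n := fun n => by
    refine (LaurentPolynomial.eval₂_T (algebraMap k (k[T;T⁻¹] ⊗[k] Nbhd k n)) (w n) 1).trans ?_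
    rw [zpow_one]
  have hm : IsMoebius t 1 β := fun n => by
    rw [hβ]; exact hw n
  refine ⟨β, hm.isNbhdAct fun h => (chartEmb_isLoc k 0).algHom_ext
    (Polynomial.algHom_ext (by simpa [chartEmb_X] using h)), fun i n => Polynomial.algHom_ext ?_⟩
  let θ := Algebra.TensorProduct.map (chartEmb k i) (AlgHom.id k (Nbhd k n))
  have hθ : ∀ j l, θ (linForm Polynomial.X n j l) = linForm (chartEmb k i Polynomial.X) n j l :=
    fun j l => by simp [θ, linForm]
  have h2 := congrArg θ (chartAct_isMoebius k i n)
  change β n (chartEmb k i Polynomial.X) = θ (chartAct k i n Polynomial.X)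
  rw [map_mul, hθ, hθ] at h2
  apply (linForm_unit (k := k) (chartEmb k i Polynomial.X) n (1 - i)).mul_right_cancel
  rw [h2]
  fin_cases i
  · simp only [chartEmb_X]
    exact hm n
  · simp only [chartEmb_X]
    change β n s * linForm s n 0 1 = linForm s n 0 0
    have h3 : ∀ l, t ⊗ₜ 1 * linForm (k := k) s n 0 l = linForm t n 1 l := fun l => by
      simp [linForm, mul_add, hts, add_comm]
    have h4 : β n t * β n s = 1 := by rw [← map_mul, hts, map_one]
    have h5 : s ⊗ₜ[k] (1 : Nbhd k n) * t ⊗ₜ 1 = 1 := by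
      rw [Algebra.TensorProduct.tmul_mul_tmul, mul_comm, hts, one_mul]; rfl
    have h6 := hm n
    change β n t * linForm t n 1 0 = linForm t n 1 1 at h6
    rw [← h3, ← h3] at h6
    linear_combination (-β n s * (s ⊗ₜ[k] (1 : Nbhd k n))) * h6 +
      (s ⊗ₜ[k] (1 : Nbhd k n) * t ⊗ₜ 1) * linForm s n 0 0 * h4 +
      (linForm s n 0 0 - β n s * linForm s n 0 1) * h5

theorem contract_map {R B : Type} [CommRing R] [Algebra k R] [CommRing B] [Algebra k B]
    (φ : R →ₐ[k] B) {n : ℕ} (μ : distFil k n) (z : R ⊗[k] Nbhd k n) :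
    contract B (distBar μ) (Algebra.TensorProduct.map φ (AlgHom.id k (Nbhd k n)) z) =
      φ (contract R (distBar μ) z) := by
  induction z using TensorProduct.induction_on with
  | zero => simp
  | add x y hx hy => rw [map_add, map_add, map_add, map_add, hx, hy]
  | tmul r c => simp [contract_tmul]

theorem glue (p : ℕ) [Fact p.Prime] (m : ℕ) (u : LevelAlg p m (distFil k)) :
    resLevel p m (chartEmb_isLoc k 0) ((chartAct_isNbhdAct k 0).toLevel p m u) =
      resLevel p m (chartEmb_isLoc k 1) ((chartAct_isNbhdAct k 1).toLevel p m u) := by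
  obtain ⟨β, hβ, h⟩ := exists_overlap k
  have key : ∀ i, (resLevel p m (chartEmb_isLoc k i)).comp ((chartAct_isNbhdAct k i).toLevel p m) =
      hβ.toLevel p m := by
    intro i
    apply LevelAlg.hom_ext
    intro μ
    change resLevel p m (chartEmb_isLoc k i) ((chartAct_isNbhdAct k i).toLevel p m _) = _
    rw [IsNbhdAct.toLevel_of, IsNbhdAct.toLevel_of, resLevel_of]
    refine congrArg LevelAlg.of (Subtype.ext (resOp_eq _ _ (hβ.opLin _ μ).2 fun f => ?_))
    change contract _ _ (β _ (chartEmb k i f)) = _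
    rw [show β _ (chartEmb k i f) = _ from DFunLike.congr_fun (h i _) f]
    exact contract_map k _ μ _
  exact (DFunLike.congr_fun (key 0) u).trans (DFunLike.congr_fun (key 1) u).symm

end Charts

/-! ### Global sections on the projective line -/

section Global

variable (p : ℕ) [Fact p.Prime] (m : ℕ)

instance : CharP (ZMod p)[T;T⁻¹] p :=
  charP_of_injective_algebraMap (FaithfulSMul.algebraMap_injective (ZMod p) (ZMod p)[T;T⁻¹]) p

/-- The ring `H⁰(ℙ¹, 𝒟^(m))`: pairs of sections over the two standard charts with the same
restriction to the intersection. -/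
def globalD : Subalgebra (ZMod p) (Fin 2 → DLevel (ZMod p) (ZMod p)[X] p m) :=
  AlgHom.equalizer
    ((resLevel p m (chartEmb_isLoc (ZMod p) 0)).comp (Pi.evalAlgHom _ _ 0))
    ((resLevel p m (chartEmb_isLoc (ZMod p) 1)).comp (Pi.evalAlgHom _ _ 1))

/-- The group `H⁰(ℙ¹, F^* 𝒟^(m))`: pairs of sections over the two standard charts with the same
restriction to the intersection. -/
def globalFD : AddSubgroup (Fin 2 → FrobPull p m (ZMod p)[X]) :=
  AddMonoidHom.eqLocus
    ((resPull p m (chartEmb_isLoc (ZMod p) 0)).comp (Pi.evalAddMonoidHom _ 0))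
    ((resPull p m (chartEmb_isLoc (ZMod p) 1)).comp (Pi.evalAddMonoidHom _ 1))

/-- The morphism `ρ_m : U^(m) → H⁰(ℙ¹, 𝒟^(m))` induced by the action of `SL₂`. -/
def rho : UEnv p m →ₐ[ZMod p] globalD p m :=
  (AlgHom.pi fun i => (chartAct_isNbhdAct (ZMod p) i).toLevel p m).codRestrict (globalD p m)
    fun u => glue (ZMod p) p m u

/-- The map `H⁰(ℙ¹, 𝒟^(m)) → H⁰(ℙ¹, F^* 𝒟^(m))`, `P ↦ 1 ⊗ P`. -/
def oneTensor : globalD p m →+ globalFD p m :=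
  AddMonoidHom.mk' (fun P => ⟨fun i => toTwist p 1 ⊗ₜ[(ZMod p)[X]] P.1 i, by
      change resPull p m (chartEmb_isLoc (ZMod p) 0) (toTwist p 1 ⊗ₜ[(ZMod p)[X]] P.1 0) =
        resPull p m (chartEmb_isLoc (ZMod p) 1) (toTwist p 1 ⊗ₜ[(ZMod p)[X]] P.1 1)
      rw [resPull_tmul, resPull_tmul, map_one, map_one]
      exact congrArg _ P.2⟩)
    fun P Q => Subtype.ext (funext fun _ => TensorProduct.tmul_add _ _ _)

/-- The map induced on the global sections by the canonical map `𝒟^(m+1) → F^* 𝒟^(m)`. -/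
def canGlobal : globalD p (m + 1) →+ globalFD p m :=
  AddMonoidHom.mk' (fun P => ⟨fun i => (isCoord_X p).can (P.1 i), by
      change resPull p m (chartEmb_isLoc (ZMod p) 0) ((isCoord_X p).can (P.1 0)) =
        resPull p m (chartEmb_isLoc (ZMod p) 1) ((isCoord_X p).can (P.1 1))
      rw [(isCoord_X p).can_res ((isCoord_X p).of_isLoc (chartEmb_isLoc (ZMod p) 0)),
        (isCoord_X p).can_res ((isCoord_X p).of_isLoc (chartEmb_isLoc (ZMod p) 1)),
        IsCoord.can_eq _ ((isCoord_X p).of_isLoc (chartEmb_isLoc (ZMod p) 1))]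
      exact congrArg _ P.2⟩)
    fun P Q => Subtype.ext (funext fun _ => map_add _ _ _)

end Global

end ArithD

end

namespace ArithD

/-! ### Frobenius and the action of distributions on functions -/

section FrobeniusCompat

variable {p : ℕ} [Fact p.Prime]

/-! The square commutes because the action of `SL₂` on the projective line is defined over the prime
field, so that it commutes with Frobenius. On functions this reads as follows. Let `α` be the
coaction of an infinitesimal neighbourhood of the identity on `R`, and let `α h = ∑ r_s ⊗ c_s`. As
`α` is a ring morphism in characteristic `p`, `α (h ^ p) = ∑ r_s ^ p ⊗ c_s ^ p`. A distribution `μ`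
contracts this to `∑ μ (c_s ^ p) r_s ^ p`. The scalars `μ (c_s ^ p) = (Fr μ) (c_s)` lie in the prime
field and are their own `p`-th powers, so the sum is `(∑ (Fr μ) (c_s) r_s) ^ p`. Hence `μ · h ^ p =
((Fr μ) · h) ^ p`; this is `contract_pow`, then `actOp_pow`.

This identity gives the square on the generators of `U^(m+1)`. If `x` is a coordinate, `F^* 𝒟^(m)`
has the basis `x ^ i ⊗ 1`, `0 ≤ i < p`, as a right `𝒟^(m)`-module. An operator `P` acts on it
through the matrix of the `P_ij` with `P (x ^ j h ^ p) = ∑ x ^ i (P_ij h) ^ p`, and `can P = P · (1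
⊗ 1)` is the column of index `0`. Only the values of `P` on `p`-th powers enter this column. For the
operator of `μ` it is therefore the operator of `Fr μ` followed by zeros (`entry_actOp`), which
means `μ · (1 ⊗ 1) = 1 ⊗ Fr μ`.

It remains to treat products of generators. The map `can` is not a morphism of rings, and an element
of `𝒟^(m)` is a class of tensors, so its action on functions cannot be used to test equalities. The
matrix representation of `𝒟^(m+1)` serves instead. It commutes with the right multiplication by
`𝒟^(m)`, so that, writing `ρ` for the two maps from distributions to operators, `ρ(uv) · (1 ⊗ 1) =
ρ(u) · (1 ⊗ ρ(Fr v)) = (ρ(u) · (1 ⊗ 1)) ρ(Fr v) = 1 ⊗ ρ(Fr u) ρ(Fr v)` as soon as the formula is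
known for `u` and for `v`. The elements that satisfy it thus form a subalgebra which contains the
generators; this is `frobAction_toLevel`.

The argument uses nothing of the action but the axioms of `IsNbhdAct`, and no formula for the
homographies. It applies to each of the two standard charts, and a global section is determined by
its components there. -/

theorem add_pow_of_zmod_algebra {C : Type*} [CommRing C] [Algebra (ZMod p) C] (a b : C) :
    (a + b) ^ p = a ^ p + b ^ p := by
  -- The zero ring has characteristic `1`, not `p`, so it is set apart. In the other case the prime
  -- field embeds in `C`. Assuming only an algebra structure lets the lemma apply to `R ⊗ Nbhd` with
  -- no proof that this ring is nonzero.
  rcases subsingleton_or_nontrivial C with _ | _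
  · exact Subsingleton.elim _ _
  · have : CharP C p := charP_of_injective_algebraMap (algebraMap (ZMod p) C).injective p
    exact add_pow_char a b p

/-- Needed because `Fr μ` has order about `p` times smaller than `μ`, while the comparison of the
two contractions takes place on a single neighbourhood, that of `μ`. -/
theorem distFil_mono {k : Type*} [CommRing k] {a b : ℕ} (h : a ≤ b) : distFil k a ≤ distFil k b :=
  fun _ hμ f hf => hμ f (Ideal.pow_le_pow_right (Nat.succ_le_succ h) hf)

variable {R : Type*} [CommRing R] [Algebra (ZMod p) R]

/-- The core of the proof: the contraction against `μ` turns the Frobenius of `R ⊗ 𝒪` into the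
Frobenius of `R`, at the price of replacing `μ` by its transpose under Frobenius. Both sides are
additive in `z`, since the `p`-th power is additive in `R ⊗ 𝒪` and in `R`, so pure tensors suffice.
Both forms are taken at the same order `n` because `z` and `z ^ p` live over the same neighbourhood;
the sharper bound on the order of `Fr μ` plays no role here. -/
theorem contract_pow {n : ℕ} (μ : distFil (ZMod p) n) (hν : frDual p μ.1 ∈ distFil (ZMod p) n)
    (z : R ⊗[ZMod p] Nbhd (ZMod p) n) :
    contract R (distBar μ) (z ^ p) = contract R (distBar ⟨frDual p μ.1, hν⟩) z ^ p := by
  induction z using TensorProduct.induction_on with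
  | zero => simp [(Fact.out : p.Prime).ne_zero]
  | add x y hx hy => rw [add_pow_of_zmod_algebra, map_add, map_add, add_pow_of_zmod_algebra, hx, hy]
  | tmul r c =>
    -- `Fr μ` is defined by its values on functions of the whole group, so the function on the
    -- neighbourhood is lifted to `SLRing` before the two forms are evaluated.
    obtain ⟨c, rfl⟩ := toNbhd_surjective n c
    -- For `r ⊗ c` the two sides become `μ (c ^ p) • r ^ p` and `(μ (c ^ p) • r) ^ p`. They agree
    -- because `λ ^ p = λ` for `λ` in the prime field, which is the role of `ZMod.pow_card`; over a
    -- larger field a Frobenius twist of the scalars would appear.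
    rw [Algebra.TensorProduct.tmul_pow, contract_tmul, contract_tmul, ← map_pow, distBar_apply,
      distBar_apply, frDual_apply, smul_pow, ZMod.pow_card]

namespace IsNbhdAct

variable {α : ∀ n, R →ₐ[ZMod p] R ⊗[ZMod p] Nbhd (ZMod p) n}

/-- The action of distributions is compatible with Frobenius: `μ (h ^ p) = ((Fr μ) h) ^ p`. -/
theorem actOp_pow (hα : IsNbhdAct α) {a b : ℕ} (hab : a / p = b) (μ : distFil (ZMod p) a) (h : R) :
    actOp (α a) μ (h ^ p) = actOp (α b) ⟨frDual p μ.1, frDual_mem p hab μ.2⟩ h ^ p := by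
  have hν := frDual_mem p hab μ.2
  -- `Fr μ` is used with two orders. Its true bound `b = a / p` is the one in the conclusion, and is
  -- what level `m` requires. The weaker bound `a` places it on the neighbourhood where `α a (h ^
  -- p)` is computed.
  have hν' : frDual p μ.1 ∈ distFil (ZMod p) a :=
    distFil_mono (hab ▸ Nat.div_le_self a p) hν
  -- The operator of a distribution does not depend on the neighbourhood chosen to compute it, so
  -- the right side may be moved from order `b` to order `a`.
  rw [← hα.actOp_eq hν hν']
  change contract R (distBar μ) (α a (h ^ p)) = _
  -- Here enters the multiplicativity of the coaction: functions on `Spec R` are pulled back by a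
  -- ring morphism, so their `p`-th powers go to `p`-th powers.
  rw [map_pow]
  exact contract_pow μ hν' _

/-! ### The column of `1 ⊗ 1` in the inverse image by Frobenius -/

variable [CharP R p] {x : R}

/-- The column of index `0` records the values on `x ^ 0 h ^ p = h ^ p`, and `actOp_pow` says that
these are again `p`-th powers, with no component along `x ^ i` for `i ≠ 0`. The uniqueness of the
components in the basis of the `x ^ i` then determines the entries. The other columns have no such
simple form in general, because `α` also moves `x ^ j`; they are never needed, since `can` only sees
the image of `1 ⊗ 1`. -/
theorem entry_actOp (hα : IsNbhdAct α) (hx : IsCoord p x) (h0 : 0 < p) {a b : ℕ} (hab : a / p = b)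
    (μ : distFil (ZMod p) a) (i : Fin p) : hx.entry (actOp (α a) μ) i ⟨0, h0⟩ =
      if i = ⟨0, h0⟩ then actOp (α b) ⟨frDual p μ.1, frDual_mem p hab μ.2⟩ else 0 := by
  -- All the entries of the column are proposed at once, since it is the whole expansion `∑ x ^ i
  -- (E_i r) ^ p` that characterizes them.
  refine hx.entry_eq (fun i => if i = ⟨0, h0⟩ then
    actOp (α b) ⟨frDual p μ.1, frDual_mem p hab μ.2⟩ else 0) (fun r => ?_) i
  rw [Finset.sum_eq_single ⟨0, h0⟩]
  · simp [hα.actOp_pow hab]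
  · intro i _ hi
    rw [if_neg hi, LinearMap.zero_apply, zero_pow h0.ne', mul_zero]
  · simp

/-- The image of `U^(m+1)` acts on `1 ⊗ 1` through the Frobenius. -/
theorem frobAction_toLevel (hα : IsNbhdAct α) (hx : IsCoord p x) (h0 : 0 < p) (m : ℕ)
    (u : UEnv p (m + 1)) : ∀ i : Fin p,
    hx.frobAction (hα.toLevel p (m + 1) u) i ⟨0, h0⟩ =
      if i = ⟨0, h0⟩ then hα.toLevel p m (frU p m u) else 0 := by
  -- The index `i` stays universally quantified in the induction: for a product `a * b`, the whole
  -- column of `b` is required, not only its entry in row `i`.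
  induction u using LevelAlg.induction with
  | scalar c =>
    intro i
    -- All the maps involved are morphisms of algebras over the prime field, and a scalar acts by a
    -- scalar matrix, whose column of index `0` has the required shape.
    simp only [AlgHom.commutes, Matrix.algebraMap_matrix_apply]
  | add a b ha hb =>
    intro i
    simp only [map_add, Matrix.add_apply, ha, hb]
    split_ifs <;> simp
  | mul a b ha hb =>
    intro i
    -- Only the column of `b` is rewritten at this point. As it is supported in row `0`, the sum
    -- over `l` retains a single entry of `a`, in column `0`, where the hypothesis on `a` applies.
    -- The unknown columns of `a` are multiplied by zero. This is the matrix form of the right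
    -- `𝒟^(m)`-linearity of the action, and the order of the factors is the one preserved by the
    -- Frobenius of the enveloping algebras.
    simp only [map_mul, Matrix.mul_apply, hb]
    rw [Finset.sum_eq_single ⟨0, h0⟩]
    · rw [ha, if_pos rfl, ite_mul, zero_mul]
    · intro l _ hl
      rw [if_neg hl, mul_zero]
    · simp
  | of μ =>
    intro i
    rw [toLevel_of, frU_of, toLevel_of, IsCoord.frobAction_of, IsCoord.mat_apply]
    -- On a generator the matrix consists of classes of actual operators, so an identity of
    -- operators on functions suffices. The orders fit because `(2 p ^ (m + 1) - 1) / p = 2 p ^ m -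
    -- 1`: the same division by `p` bounds the order of the entries and that of `Fr μ`.
    refine (opOf_congr (hα.entry_actOp hx h0 (IsCoord.div_level m).1 μ i) _).trans ?_
    split_ifs with hi
    -- In row `0` both sides are the class of the operator of `Fr μ`; only the proofs of the bound
    -- on its order differ. In the other rows there remains the class of the zero operator.
    · exact opOf_congr rfl _
    · exact map_zero LevelAlg.of

/-- The commutativity of the square over one affine chart, for any action of the neighbourhoods and
any coordinate. It rereads the matrix identity in the tensor product: the components `x ^ i ⊗ P_i0`
of `P · (1 ⊗ 1)` vanish for `i ≠ 0`, and the remaining one is `x ^ 0 ⊗ P_00 = 1 ⊗ P_00`. -/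
theorem can_toLevel (hα : IsNbhdAct α) (hx : IsCoord p x) (m : ℕ) (u : UEnv p (m + 1)) :
    hx.can (hα.toLevel p (m + 1) u) = toTwist p 1 ⊗ₜ[R] hα.toLevel p m (frU p m u) := by
  have h0 := (Fact.out : p.Prime).pos
  rw [IsCoord.can_apply, Finset.sum_eq_single ⟨0, h0⟩]
  · rw [hα.frobAction_toLevel hx h0, if_pos rfl, pow_zero]
  · intro i _ hi
    rw [hα.frobAction_toLevel hx h0, if_neg hi, TensorProduct.tmul_zero]
  · simp

end IsNbhdAct

end FrobeniusCompat

end ArithD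

/-! ### The square on the projective line -/

theorem proposition3p1p1 (p : ℕ) [Fact p.Prime] (hp : 2 < p) (m : ℕ)
    (u : ArithD.UEnv p (m + 1)) :
    ArithD.canGlobal p m (ArithD.rho p (m + 1) u) =
      ArithD.oneTensor p m (ArithD.rho p m (ArithD.frU p m u)) :=
  -- Global sections are pairs of sections over the charts, so equality is tested on each chart with
  -- its own coordinate. No gluing remains to be checked here: the agreement on the intersection is
  -- part of the construction of `rho`, `canGlobal` and `oneTensor`, through `glue`,
  -- `IsCoord.can_eq` and `IsCoord.can_res`.
  Subtype.ext (funext fun i =>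
    (ArithD.chartAct_isNbhdAct (ZMod p) i).can_toLevel (ArithD.isCoord_X p) m u)
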